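/- The binary Hamming graph $H(m,2)$ has vertex set $\mathbb{F}_2^m$, two vertices being adjacent iff they differ in exactly one entry; $d$ is the Hamming distance. Two codes $C,C'\subseteq\mathbb{F}_2^m$ are equivalent if some automorphism of the graph $H(m,2)$ maps $C$ onto $C'$. The minimum distance $\delta$ of $C$ is the smallest distance between distinct codewords (in particular $|C|\ge 2$). For a nonempty code $C$ let $C_i$ be the set of vertices at distance $i$ from $C$, and let the covering radius $\rho$ be the largest $i$ with $C_i\neq\emptyset$. The code $C$ is completely regular if for all $i,k$ and all $\gamma\in C_i$ the number of codewords at distance $k$ from $\gamma$ depends only on $i$ and $k$. It is completely transitive if there is a subgroup $G\le\operatorname{Aut}(H(m,2))$ such that each of $C_0,\dots,C_\rho$ is a $G$-orbit. For a $12\times 12$ Hadamard matrix $H$ (entries $\pm1$, $HH^T=12I$), the code $C(H)\subseteq\mathbb{F}_2^{12}$ consists of the vectors obtained from the rows of $H$ and of $-H$ by replacing $1$ by $0$ and $-1$ by $1$. A Hadamard $12$ code is $C(H)$ for a normalised such $H$, that is, one whose first row and first column have all entries equal to $1$. A punctured Hadamard $12$ code is obtained from a Hadamard $12$ code by deleting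 the first entry of every codeword. Theorem. Let $C$ be a binary completely regular code of length $m$ with minimum distance $\delta$. (a) If $m=12$ and $\delta=6$, then $C$ is equivalent to every Hadamard $12$ code. (b) If $m=11$ and $\delta=5$, then $C$ is equivalent to every punctured Hadamard $12$ code. Moreover, the codes $C$ in (a) and (b) are completely transitive. -/

import Mathlib

/-- The vertices of the binary Hamming graph `H(m,2)`: the `m`-tuples over `𝔽₂`. -/
abbrev HammingVertex (m : ℕ) : Type := Fin m → ZMod 2

/-- A binary code of length `m`: a set of vertices of `H(m,2)` (automatically finite). -/
abbrev BinaryCode (m : ℕ) : Type := Finset (HammingVertex m)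

/-- The binary Hamming graph `H(m,2)`: two vertices are adjacent iff they differ in precisely
one entry. -/
def hammingGraph (m : ℕ) : SimpleGraph (HammingVertex m) where
  Adj α β := hammingDist α β = 1
  symm := ⟨fun α β h => by rw [hammingDist_comm]; exact h⟩
  loopless := ⟨fun α h => by simp at h⟩

/-- The automorphism group of `H(m,2)`. -/
abbrev HammingAut (m : ℕ) : Type := hammingGraph m ≃g hammingGraph m

/-- Two codes in `H(m,2)` are equivalent if some automorphism of `H(m,2)` maps one onto the
other. -/
def AreEquivalentCodes {m : ℕ} (C D : BinaryCode m) : Prop :=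
  ∃ x : HammingAut m, C.image (fun α => x α) = D

/-- `δ` is the minimum distance of `C`: the smallest distance between distinct codewords
(so `C` has at least two codewords). -/
def HasMinDistance {m : ℕ} (C : BinaryCode m) (δ : ℕ) : Prop :=
  IsLeast {d : ℕ | ∃ α ∈ C, ∃ β ∈ C, α ≠ β ∧ hammingDist α β = d} δ

/-- The distance of the vertex `γ` from a (nonempty) code `C`. -/
noncomputable def distToCode {m : ℕ} (C : BinaryCode m) (γ : HammingVertex m) : ℕ :=
  sInf {d : ℕ | ∃ β ∈ C, hammingDist γ β = d}

/-- The cell `C_i` of the distance partition of `C`: the vertices at distance `i` from `C`. -/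
def distCell {m : ℕ} (C : BinaryCode m) (i : ℕ) : Set (HammingVertex m) :=
  {γ | distToCode C γ = i}

/-- The covering radius of `C`: the maximum distance of a vertex from `C`. -/
noncomputable def coveringRadius {m : ℕ} (C : BinaryCode m) : ℕ :=
  Finset.univ.sup (distToCode C)

/-- `C` is completely regular: for `γ ∈ C_i`, the number of codewords at distance `k` from `γ`
depends only on `i` and `k`. -/
def IsCompletelyRegular {m : ℕ} (C : BinaryCode m) : Prop :=
  ∀ i k : ℕ, ∀ γ ∈ distCell C i, ∀ γ' ∈ distCell C i,
    (C.filter fun β => hammingDist γ β = k).card = (C.filter fun β => hammingDist γ' β = k).card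

/-- `C` is completely transitive: there is a subgroup `G` of the automorphism group of `H(m,2)`
such that each cell `C_0, …, C_ρ` of the distance partition is a `G`-orbit. -/
def IsCompletelyTransitive {m : ℕ} (C : BinaryCode m) : Prop :=
  ∃ G : Subgroup (HammingAut m), ∀ i ≤ coveringRadius C,
    ∃ γ : HammingVertex m, distCell C i = MulAction.orbit G γ

/-- The map `κ` from `±1`-vectors to binary vectors, sending `-1` to `1` and `1` to `0`. -/
def signToBinary {m : ℕ} (r : Fin m → ℤ) : HammingVertex m :=
  fun j => if r j = -1 then 1 else 0

/-- The Hadamard code `C(H)`: all `κ(r)`, where `r` is a row of `H` or of `-H`. -/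
def hadamardCode {m : ℕ} (H : Matrix (Fin m) (Fin m) ℤ) : BinaryCode m :=
  Finset.univ.image (fun i => signToBinary (H i)) ∪
    Finset.univ.image (fun i => signToBinary ((-H) i))

/-- `D` is a Hadamard 12 code: it is generated by a Hadamard matrix of order 12 that is
normalised, that is, whose first row and first column have all entries equal to `1`. -/
def IsHadamardTwelveCode (D : BinaryCode 12) : Prop :=
  ∃ H : Matrix (Fin 12) (Fin 12) ℤ,
    H.IsHadamard ∧ (∀ j, H 0 j = 1) ∧ (∀ i, H i 0 = 1) ∧ D = hadamardCode H

/-- The punctured code of `C` with respect to `p`: delete the entry `p` from each codeword. -/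
def puncturedCode {m : ℕ} (p : Fin (m + 1)) (C : BinaryCode (m + 1)) : BinaryCode m :=
  C.image (fun α j => α (p.succAbove j))

/-- `D` is a punctured Hadamard 12 code: it arises from a Hadamard 12 code by deleting the first
entry of each codeword. -/
def IsPuncturedHadamardTwelveCode (D : BinaryCode 11) : Prop :=
  ∃ E : BinaryCode 12, IsHadamardTwelveCode E ∧ D = puncturedCode 0 E

/-- A normalised Hadamard matrix of order 12, from the quadratic residues modulo 11. -/
def paleyTwelve : Matrix (Fin 12) (Fin 12) ℤ := fun i j =>
  if i = 0 ∨ j = 0 then 1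
  else if (j.val + 11 - i.val) % 11 ∈ [0, 1, 3, 4, 5, 9] then -1 else 1

set_option maxRecDepth 100000 in
/-- Hadamard 12 codes exist. -/
theorem isHadamardTwelveCode_paleyTwelve : IsHadamardTwelveCode (hadamardCode paleyTwelve) := by
  refine ⟨paleyTwelve, ⟨?_, ?_, ?_⟩, by decide, by decide, rfl⟩
  · intro i j
    rw [Unitary.mem_iff]
    unfold paleyTwelve
    split_ifs <;> decide
  · ext i j
    revert i j
    simp only [Matrix.mul_apply, Matrix.conjTranspose_apply, star_trivial, Matrix.smul_apply,
      Matrix.one_apply, Fintype.card_fin]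
    decide +kernel
  · ext i j
    revert i j
    simp only [Matrix.mul_apply, Matrix.conjTranspose_apply, star_trivial, Matrix.smul_apply,
      Matrix.one_apply, Fintype.card_fin]
    decide +kernel

/-!
Translate a codeword to zero. By complete regularity the words of minimum weight `δ` form a
`⌊δ / 2⌋`-design, and as two blocks meet in few entries, counting leaves only a `3`-`(12, 6, 2)`
design for length 12 and a `2`-`(11, 5, 2)` design for length 11. Counting the blocks by the size of
their intersection with a word of weight 6 shows that the complement of this word is a block, so the
code is closed under complementation. Hence the code, or its extension by a parity entry, consists
of the rows of `H` and `-H` for a Hadamard matrix `H` of order 12.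

Any three entries are the intersection of precisely two supports of weight 6, and these cut the
twelve entries into the columns of a `4 × 3` grid. The supports meeting the first column in one
point then form a tetracode, which is unique; more precisely, the three entries and any fourth
entry outside the two supports can be prescribed when two such codes are identified. By the Norse
bound every vertex differs from a closest codeword in at most four entries, and these can be
included among the prescribed ones. So any two vertices at the same distance from two such codes
correspond under an automorphism that carries one code onto the other. In the punctured case,
vertices are lifted to length 12 so that the deleted entry is among the prescribed ones.
-/

section Designs

open Finset symmDiff

variable {α : Type*} [DecidableEq α]

theorem card_symmDiff_add_two_mul_card_inter (A B : Finset α) :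
    #(A ∆ B) + 2 * #(A ∩ B) = #A + #B := by
  have hA := card_sdiff_add_card_inter A B
  have hB := card_sdiff_add_card_inter B A
  have hAB : #(A ∆ B) = #(A \ B) + #(B \ A) := card_union_of_disjoint disjoint_sdiff_sdiff
  rw [inter_comm B A] at hB
  omega

theorem eq_of_card_symmDiff_eq_zero {A B : Finset α} (h : #(A ∆ B) = 0) : A = B :=
  symmDiff_eq_bot.1 (card_eq_zero.1 h)

theorem eq_compl_of_disjoint_of_card_add_card [Fintype α] {A B : Finset α} (h : Disjoint A B)
    (hc : #A + #B = Fintype.card α) : A = Bᶜ :=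
  eq_of_subset_of_card_le (subset_compl_iff_disjoint_right.2 h) (by rw [card_compl]; omega)

/-- A family `𝓑` of `k`-subsets (blocks) of `α` is a `t`-`(v, k, l)` design, where `v` is the
cardinality of `α`, if every `t`-subset is contained in precisely `l` blocks. -/
structure IsDesign (t k l : ℕ) (𝓑 : Finset (Finset α)) : Prop where
  card_block : ∀ B ∈ 𝓑, #B = k
  card_through : ∀ T : Finset α, #T = t → #{B ∈ 𝓑 | T ⊆ B} = l

namespace IsDesign

variable {t k l : ℕ} {𝓑 : Finset (Finset α)}

theorem sum_choose_card_inter (h : IsDesign t k l 𝓑) (S : Finset α) :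
    ∑ B ∈ 𝓑, (#(B ∩ S)).choose t = (#S).choose t * l := by
  have hpow (B : Finset α) : powersetCard t (B ∩ S) = {T ∈ powersetCard t S | T ⊆ B} := by
    ext T
    simp only [mem_powersetCard, mem_filter, subset_inter_iff]
    tauto
  calc ∑ B ∈ 𝓑, (#(B ∩ S)).choose t
      = ∑ B ∈ 𝓑, #{T ∈ powersetCard t S | T ⊆ B} := by simp only [← card_powersetCard, hpow]
    _ = ∑ T ∈ powersetCard t S, #{B ∈ 𝓑 | T ⊆ B} := by
        simp only [card_filter]
        exact sum_comm
    _ = ∑ _T ∈ powersetCard t S, l :=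
        sum_congr rfl fun T hT => h.card_through T (mem_powersetCard.1 hT).2
    _ = (#S).choose t * l := by rw [sum_const, smul_eq_mul, card_powersetCard]

theorem card_eq (h : IsDesign 0 k l 𝓑) : #𝓑 = l := by
  simpa using h.card_through ∅ card_empty

theorem one_le (h : IsDesign t k l 𝓑) (hne : 𝓑.Nonempty) (htk : t ≤ k) : 1 ≤ l := by
  obtain ⟨B, hB⟩ := hne
  obtain ⟨T, hTB, hT⟩ := exists_subset_card_eq (htk.trans_eq (h.card_block B hB).symm)
  rw [← h.card_through T hT, one_le_card]
  exact ⟨B, mem_filter.2 ⟨hB, hTB⟩⟩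

theorem sum_sub_one_mul_sub_three {b r : ℕ} (h₂ : IsDesign 2 k l 𝓑) (h₁ : IsDesign 1 k r 𝓑)
    (h₀ : IsDesign 0 k b 𝓑) (S : Finset α) :
    ∑ B ∈ 𝓑, ((#(B ∩ S) : ℤ) - 1) * (#(B ∩ S) - 3) = #S * (#S - 1) * l - 3 * #S * r + 3 * b := by
  have hchoose (n : ℕ) : (n : ℤ) * (n - 1) = 2 * (n.choose 2 : ℕ) := by
    qify
    rw [Nat.cast_choose_two]
    ring
  have s₁ := h₁.sum_choose_card_inter S
  have s₂ := h₂.sum_choose_card_inter S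
  simp only [Nat.choose_one_right] at s₁
  zify at s₁ s₂
  calc ∑ B ∈ 𝓑, ((#(B ∩ S) : ℤ) - 1) * (#(B ∩ S) - 3)
      = ∑ B ∈ 𝓑, (2 * ((#(B ∩ S)).choose 2 : ℕ) - 3 * (#(B ∩ S) : ℤ) + 3) :=
        sum_congr rfl fun B _ => by linear_combination hchoose (#(B ∩ S))
    _ = 2 * ((#S).choose 2 * l) - 3 * (#S * r) + 3 * b := by
        rw [sum_add_distrib, sum_sub_distrib, ← mul_sum, ← mul_sum, s₁, s₂, sum_const, h₀.card_eq,
          nsmul_eq_mul, mul_comm (b : ℤ)]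
    _ = #S * (#S - 1) * l - 3 * #S * r + 3 * b := by linear_combination -hchoose (#S) * l

variable [Fintype α]

theorem card_through_mul (h : IsDesign (t + 1) k l 𝓑) {T : Finset α} (hT : #T = t) :
    #{B ∈ 𝓑 | T ⊆ B} * (k - t) = (Fintype.card α - t) * l := by
  have hext (B : Finset α) : B \ T = {x ∈ Tᶜ | x ∈ B} := by
    ext x
    simp only [mem_sdiff, mem_filter, mem_compl, and_comm]
  calc #{B ∈ 𝓑 | T ⊆ B} * (k - t)
      = ∑ B ∈ 𝓑 with T ⊆ B, #(B \ T) := by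
        rw [← smul_eq_mul, ← sum_const]
        refine sum_congr rfl fun B hB => ?_
        rw [mem_filter] at hB
        rw [card_sdiff_of_subset hB.2, h.card_block B hB.1, hT]
    _ = ∑ x ∈ Tᶜ, #{B ∈ {B ∈ 𝓑 | T ⊆ B} | x ∈ B} := by
        simp only [hext]
        exact sum_card_bipartiteAbove_eq_sum_card_bipartiteBelow fun B x => x ∈ B
    _ = ∑ _x ∈ Tᶜ, l := by
        refine sum_congr rfl fun x hx => ?_
        rw [← h.card_through (insert x T)
          (by rw [card_insert_of_notMem (mem_compl.1 hx), hT]), filter_filter]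
        simp only [insert_subset_iff, and_comm]
    _ = (Fintype.card α - t) * l := by rw [sum_const, smul_eq_mul, card_compl, hT]

theorem of_succ (h : IsDesign (t + 1) k l 𝓑) {r : ℕ} (htk : t < k)
    (hr : r * (k - t) = (Fintype.card α - t) * l) : IsDesign t k r 𝓑 where
  card_block := h.card_block
  card_through _ hT :=
    Nat.eq_of_mul_eq_mul_right (Nat.sub_pos_of_lt htk) ((h.card_through_mul hT).trans hr.symm)

/-- The blocks through a `t`-set are pairwise disjoint outside it. -/
theorem mul_le_of_card_inter_le (h : IsDesign t k l 𝓑) (ht : t ≤ Fintype.card α)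
    (hI : ∀ B ∈ 𝓑, ∀ B' ∈ 𝓑, B ≠ B' → #(B ∩ B') ≤ t) : l * (k - t) ≤ Fintype.card α - t := by
  obtain ⟨T, -, hT⟩ := exists_subset_card_eq (s := (univ : Finset α)) ht
  have hdisj : ∀ B ∈ ({B ∈ 𝓑 | T ⊆ B} : Finset (Finset α)),
      ∀ B' ∈ ({B ∈ 𝓑 | T ⊆ B} : Finset (Finset α)), B ≠ B' → Disjoint (B \ T) (B' \ T) := by
    intro B hB B' hB' hne
    rw [mem_filter] at hB hB'
    have hTI : T = B ∩ B' := eq_of_subset_of_card_le (subset_inter hB.2 hB'.2)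
      (hT ▸ hI B hB.1 B' hB'.1 hne)
    rw [disjoint_left]
    intro x hx hx'
    rw [mem_sdiff] at hx hx'
    exact hx.2 (hTI ▸ mem_inter.2 ⟨hx.1, hx'.1⟩)
  calc l * (k - t) = ∑ B ∈ 𝓑 with T ⊆ B, #(B \ T) := by
        rw [← h.card_through T hT, ← smul_eq_mul, ← sum_const]
        refine sum_congr rfl fun B hB => ?_
        rw [mem_filter] at hB
        rw [card_sdiff_of_subset hB.2, h.card_block B hB.1, hT]
    _ = #({B ∈ 𝓑 | T ⊆ B}.biUnion fun B => B \ T) := (card_biUnion hdisj).symm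
    _ ≤ #Tᶜ := card_le_card (biUnion_subset.2 fun B _ x hx => mem_compl.2 (mem_sdiff.1 hx).2)
    _ = Fintype.card α - t := by rw [card_compl, hT]

end IsDesign

theorem exists_disjoint_of_sum_pos {𝓑 : Finset (Finset α)} {S : Finset α}
    (hpos : 0 < ∑ B ∈ 𝓑, ((#(B ∩ S) : ℤ) - 1) * (#(B ∩ S) - 3))
    (hI : ∀ B ∈ 𝓑, #(B ∩ S) ≤ 3) : ∃ B ∈ 𝓑, Disjoint B S := by
  obtain ⟨B, hB, hterm⟩ := exists_lt_of_sum_lt (by simpa using hpos : ∑ _B ∈ 𝓑, (0 : ℤ) < _)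
  refine ⟨B, hB, disjoint_iff_inter_eq_empty.2 (card_eq_zero.1 ?_)⟩
  by_contra hne
  have hle : (#(B ∩ S) : ℤ) ≤ 3 := mod_cast hI B hB
  have hge : (1 : ℤ) ≤ #(B ∩ S) := mod_cast Nat.one_le_iff_ne_zero.2 hne
  nlinarith

variable [Fintype α]

theorem IsDesign.eq_two_of_card_eq_eleven {l : ℕ} {𝓑 : Finset (Finset α)}
    (h : IsDesign 2 5 l 𝓑) (hα : Fintype.card α = 11) (hne : 𝓑.Nonempty)
    (hI : ∀ B ∈ 𝓑, ∀ B' ∈ 𝓑, B ≠ B' → #(B ∩ B') ≤ 2) : l = 2 := by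
  have hpos := h.one_le hne (by norm_num)
  have hle := h.mul_le_of_card_inter_le (by omega) hI
  obtain ⟨T, -, hT⟩ := exists_subset_card_eq (s := (univ : Finset α)) (n := 1) (by simp [hα])
  have hmul := h.card_through_mul hT
  simp only [hα] at hle hmul
  omega

theorem IsDesign.eq_two_of_card_eq_twelve {l : ℕ} {𝓑 : Finset (Finset α)}
    (h : IsDesign 3 6 l 𝓑) (hα : Fintype.card α = 12) (hne : 𝓑.Nonempty)
    (hI : ∀ B ∈ 𝓑, ∀ B' ∈ 𝓑, B ≠ B' → #(B ∩ B') ≤ 3) : l = 2 := by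
  have hpos := h.one_le hne (by norm_num)
  have hle := h.mul_le_of_card_inter_le (by omega) hI
  obtain ⟨T, -, hT⟩ := exists_subset_card_eq (s := (univ : Finset α)) (n := 2) (by simp [hα])
  have hmul := h.card_through_mul hT
  simp only [hα] at hle hmul
  omega

theorem IsDesign.compl_mem_of_card_eq_eleven {𝓑 : Finset (Finset α)} (h : IsDesign 2 5 2 𝓑)
    (hα : Fintype.card α = 11) {W : Finset α} (hW : #W = 6) (hI : ∀ B ∈ 𝓑, #(B ∩ W) ≤ 3) :
    Wᶜ ∈ 𝓑 := by
  have h₁ : IsDesign 1 5 5 𝓑 := h.of_succ (by norm_num) (by rw [hα])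
  have h₀ : IsDesign 0 5 11 𝓑 := h₁.of_succ (by norm_num) (by rw [hα])
  have hsum := h.sum_sub_one_mul_sub_three h₁ h₀ W
  rw [hW] at hsum
  obtain ⟨B, hB, hBW⟩ := exists_disjoint_of_sum_pos (by rw [hsum]; norm_num) hI
  rwa [← eq_compl_of_disjoint_of_card_add_card hBW (by rw [h.card_block B hB, hW, hα])]

theorem IsDesign.compl_mem_of_card_eq_twelve {𝓑 : Finset (Finset α)} (h : IsDesign 3 6 2 𝓑)
    (hα : Fintype.card α = 12) (hI : ∀ B ∈ 𝓑, ∀ B' ∈ 𝓑, B ≠ B' → #(B ∩ B') ≤ 3)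
    {W : Finset α} (hW : W ∈ 𝓑) : Wᶜ ∈ 𝓑 := by
  have h₂ : IsDesign 2 6 5 𝓑 := h.of_succ (by norm_num) (by rw [hα])
  have h₁ : IsDesign 1 6 11 𝓑 := h₂.of_succ (by norm_num) (by rw [hα])
  have h₀ : IsDesign 0 6 22 𝓑 := h₁.of_succ (by norm_num) (by rw [hα])
  have hcard := h.card_block W hW
  have hsum := h₂.sum_sub_one_mul_sub_three h₁ h₀ W
  rw [← add_sum_erase _ _ hW, inter_self, hcard] at hsum
  norm_num at hsum
  obtain ⟨B, hB, hBW⟩ := exists_disjoint_of_sum_pos (𝓑 := 𝓑.erase W) (S := W) (by omega)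
    fun B hB => hI B (mem_of_mem_erase hB) W hW (ne_of_mem_erase hB)
  have hB' := mem_of_mem_erase hB
  rwa [← eq_compl_of_disjoint_of_card_add_card hBW (by rw [h.card_block B hB', hcard, hα])]

end Designs

section SetSign

open Finset symmDiff

variable {α : Type*} [DecidableEq α]

/-- The `±1`-valued indicator of a set, equal to `-1` on the set. -/
def setSign (A : Finset α) (x : α) : ℤ := if x ∈ A then -1 else 1

theorem setSign_mul_self (A : Finset α) (x : α) : setSign A x * setSign A x = 1 := by
  unfold setSign
  split_ifs <;> rfl

theorem setSign_mul_setSign (A B : Finset α) (x : α) :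
    setSign A x * setSign B x = setSign (A ∆ B) x := by
  by_cases hA : x ∈ A <;> by_cases hB : x ∈ B <;> simp [setSign, mem_symmDiff, hA, hB]

theorem setSign_compl [Fintype α] (A : Finset α) (x : α) : setSign Aᶜ x = -setSign A x := by
  by_cases hA : x ∈ A <;> simp [setSign, hA]

theorem setSign_mul_setSign_eq_one_iff {A B : Finset α} {x : α} :
    setSign A x * setSign B x = 1 ↔ (x ∈ A ↔ x ∈ B) := by
  by_cases hA : x ∈ A <;> by_cases hB : x ∈ B <;> simp [setSign, hA, hB]

theorem setSign_mul_setSign_eq_one_or_neg_one (A B : Finset α) (x : α) :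
    setSign A x * setSign B x = 1 ∨ setSign A x * setSign B x = -1 := by
  rw [setSign_mul_setSign]
  unfold setSign
  split_ifs <;> simp

theorem sum_setSign (A J : Finset α) : ∑ x ∈ J, setSign A x = #J - 2 * #(A ∩ J) := by
  have hcard := card_filter_add_card_filter_not (s := J) (· ∈ A)
  rw [inter_comm, ← filter_mem_eq_inter]
  simp only [setSign, sum_ite, sum_const, nsmul_eq_mul]
  omega

theorem sum_setSign_mul_setSign (A B J : Finset α) :
    ∑ x ∈ J, setSign A x * setSign B x = #J - 2 * #((A ∆ B) ∩ J) := by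
  simp only [setSign_mul_setSign, sum_setSign]

theorem prod_one_add_setSign_mul_setSign {P T : Finset α} (hPT : P ⊆ T) (A : Finset α) :
    ∏ x ∈ T, (1 + setSign A x * setSign P x) = if A ∩ T = P then 2 ^ #T else 0 := by
  split_ifs with h
  · rw [← prod_const]
    refine prod_congr rfl fun x hx => ?_
    have hx' : x ∈ A ↔ x ∈ P := by simp [← h, hx]
    rw [setSign_mul_setSign_eq_one_iff.2 hx', one_add_one_eq_two]
  · obtain ⟨x, hxT, hx⟩ : ∃ x ∈ T, ¬(x ∈ A ↔ x ∈ P) := by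
      by_contra! hall
      refine h (ext fun x => ?_)
      rw [mem_inter]
      exact ⟨fun hx => (hall x hx.2).1 hx.1, fun hx => ⟨(hall x (hPT hx)).2 hx, hPT hx⟩⟩
    refine prod_eq_zero hxT ?_
    rw [(setSign_mul_setSign_eq_one_or_neg_one A P x).resolve_left
      (mt setSign_mul_setSign_eq_one_iff.1 hx), add_neg_cancel]

end SetSign

section HadamardFamily

open Finset symmDiff

/-- The Frobenius norms of `M Mᵀ` and `Mᵀ M` agree. -/
theorem sum_sum_sq_sum_mul_comm {ι κ R : Type*} [CommSemiring R] (s : Finset ι) (t : Finset κ)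
    (M : ι → κ → R) :
    ∑ a ∈ s, ∑ b ∈ s, (∑ x ∈ t, M a x * M b x) ^ 2 =
      ∑ x ∈ t, ∑ y ∈ t, (∑ a ∈ s, M a x * M a y) ^ 2 := by
  simp only [sq, sum_mul_sum]
  calc ∑ a ∈ s, ∑ b ∈ s, ∑ x ∈ t, ∑ y ∈ t, M a x * M b x * (M a y * M b y)
      = ∑ a ∈ s, ∑ x ∈ t, ∑ b ∈ s, ∑ y ∈ t, M a x * M b x * (M a y * M b y) :=
        sum_congr rfl fun a _ => sum_comm
    _ = ∑ x ∈ t, ∑ a ∈ s, ∑ y ∈ t, ∑ b ∈ s, M a x * M b x * (M a y * M b y) := by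
        rw [sum_comm]
        exact sum_congr rfl fun x _ => sum_congr rfl fun a _ => sum_comm
    _ = ∑ x ∈ t, ∑ y ∈ t, ∑ a ∈ s, ∑ b ∈ s, M a x * M a y * (M b x * M b y) :=
        sum_congr rfl fun x _ => sum_comm.trans <| sum_congr rfl fun y _ =>
          sum_congr rfl fun a _ => sum_congr rfl fun b _ => by ring

variable {α : Type*} [Fintype α] [DecidableEq α]

/-- The family of the supports of the codewords of a binary Hadamard code, seen from an arbitrary
vertex: the rows of `±H` for a Hadamard matrix `H`, as sets of column indices. -/
structure IsHadamardFamily (F : Finset (Finset α)) : Prop where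
  card_eq : #F = 2 * Fintype.card α
  compl_mem : ∀ A ∈ F, Aᶜ ∈ F
  card_symmDiff : ∀ A ∈ F, ∀ B ∈ F,
    #(A ∆ B) = 0 ∨ 2 * #(A ∆ B) = Fintype.card α ∨ #(A ∆ B) = Fintype.card α

theorem eq_compl_of_card_symmDiff_eq {A B : Finset α} (h : #(A ∆ B) = Fintype.card α) :
    A = Bᶜ :=
  ((symmDiff_eq_top A B).1 ((card_eq_iff_eq_univ _).1 h)).eq_compl

namespace IsHadamardFamily

variable {F : Finset (Finset α)}

theorem sum_compl {M : Type*} [AddCommMonoid M] (hF : IsHadamardFamily F) (f : Finset α → M) :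
    ∑ A ∈ F, f Aᶜ = ∑ A ∈ F, f A :=
  sum_nbij' compl compl hF.compl_mem hF.compl_mem (fun A _ => compl_compl A)
    (fun A _ => compl_compl A) fun _ _ => rfl

theorem sum_eq_zero_of_compl (hF : IsHadamardFamily F) {f : Finset α → ℤ}
    (hf : ∀ A, f Aᶜ = -f A) : ∑ A ∈ F, f A = 0 := by
  have hsum := hF.sum_compl f
  simp only [hf, sum_neg_distrib] at hsum
  omega

theorem sum_sq_sum_setSign_mul_setSign (hF : IsHadamardFamily F) {A : Finset α} (hA : A ∈ F) :
    ∑ B ∈ F, (∑ x, setSign A x * setSign B x) ^ 2 = 2 * (Fintype.card α : ℤ) ^ 2 := by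
  have hne : A ≠ Aᶜ := by
    intro h
    have hcard : 0 < #F := card_pos.2 ⟨A, hA⟩
    rw [hF.card_eq] at hcard
    have : Nonempty α := Fintype.card_pos_iff.1 (by omega)
    exact ne_compl_self h
  have hself : #(A ∆ A) = 0 := by rw [symmDiff_self]; rfl
  have hcompl : #(A ∆ Aᶜ) = Fintype.card α := by rw [symmDiff_compl_self]; exact card_univ
  rw [← sum_subset (s₁ := {A, Aᶜ}) (by simp [insert_subset_iff, hA, hF.compl_mem A hA]),
    sum_pair hne]
  · simp only [sum_setSign_mul_setSign, inter_univ, hself, hcompl, card_univ]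
    push_cast
    ring
  · intro B hB hBA
    simp only [mem_insert, mem_singleton, not_or] at hBA
    rw [sum_setSign_mul_setSign, inter_univ, card_univ]
    rcases hF.card_symmDiff B hB A hA with h | h | h
    · exact absurd (eq_of_card_symmDiff_eq_zero h) hBA.1
    · rw [symmDiff_comm, ← h]
      push_cast
      ring
    · exact absurd (eq_compl_of_card_symmDiff_eq h) hBA.2

theorem sum_setSign_mul_setSign_self (hF : IsHadamardFamily F) (x : α) :
    ∑ A ∈ F, setSign A x * setSign A x = 2 * Fintype.card α := by
  simp only [setSign_mul_self, sum_const, nsmul_eq_mul, mul_one, hF.card_eq]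
  push_cast
  rfl

theorem sum_setSign_mul_setSign_of_ne (hF : IsHadamardFamily F) {x y : α} (hxy : x ≠ y) :
    ∑ A ∈ F, setSign A x * setSign A y = 0 := by
  set G : α → α → ℤ := fun x y => ∑ A ∈ F, setSign A x * setSign A y with hG
  have htotal : ∑ x, ∑ y, G x y ^ 2 = ∑ x, G x x ^ 2 := by
    simp only [hG, ← sum_sum_sq_sum_mul_comm F univ setSign, hF.sum_setSign_mul_setSign_self]
    rw [sum_congr rfl fun A hA => hF.sum_sq_sum_setSign_mul_setSign hA]
    simp only [sum_const, nsmul_eq_mul, hF.card_eq, card_univ]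
    push_cast
    ring
  have hsplit (x : α) : ∑ y, G x y ^ 2 = G x x ^ 2 + ∑ y ∈ univ.erase x, G x y ^ 2 :=
    (add_sum_erase univ _ (mem_univ x)).symm
  have hoff : ∑ x, ∑ y ∈ univ.erase x, G x y ^ 2 = 0 := by
    simpa only [hsplit, sum_add_distrib, add_eq_left] using htotal
  have hnonneg (x : α) : 0 ≤ ∑ y ∈ univ.erase x, G x y ^ 2 := sum_nonneg fun y _ => sq_nonneg _
  have hrow := (sum_eq_zero_iff_of_nonneg fun x _ => hnonneg x).1 hoff x (mem_univ x)
  have hentry := (sum_eq_zero_iff_of_nonneg fun y _ => sq_nonneg (G x y)).1 hrow y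
    (mem_erase.2 ⟨hxy.symm, mem_univ y⟩)
  exact pow_eq_zero_iff two_ne_zero |>.1 hentry

/-- A Hadamard family is an orthogonal array of strength three. -/
theorem eight_mul_card_inter_eq (hF : IsHadamardFamily F) {T P : Finset α} (hT : #T = 3)
    (hPT : P ⊆ T) : 8 * #{A ∈ F | A ∩ T = P} = #F := by
  obtain ⟨a, b, c, hab, hac, hbc, rfl⟩ := card_eq_three.1 hT
  have hodd (x : α) : ∑ A ∈ F, setSign A x = 0 :=
    hF.sum_eq_zero_of_compl fun A => setSign_compl A x
  have hodd₃ : ∑ A ∈ F, setSign A a * setSign A b * setSign A c = 0 :=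
    hF.sum_eq_zero_of_compl fun A => by simp only [setSign_compl]; ring
  have hexpand : ∑ A ∈ F, ∏ x ∈ ({a, b, c} : Finset α), (1 + setSign A x * setSign P x) =
      ∑ A ∈ F, (1 + setSign P a * setSign A a + setSign P b * setSign A b +
        setSign P c * setSign A c + setSign P a * setSign P b * (setSign A a * setSign A b) +
        setSign P a * setSign P c * (setSign A a * setSign A c) +
        setSign P b * setSign P c * (setSign A b * setSign A c) +
        setSign P a * setSign P b * setSign P c * (setSign A a * setSign A b * setSign A c)) := by
    refine sum_congr rfl fun A _ => ?_
    rw [prod_insert (by simp [hab, hac]), prod_pair hbc]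
    ring
  simp only [prod_one_add_setSign_mul_setSign hPT, hT, sum_add_distrib, ← mul_sum, hodd, hodd₃,
    hF.sum_setSign_mul_setSign_of_ne hab, hF.sum_setSign_mul_setSign_of_ne hac,
    hF.sum_setSign_mul_setSign_of_ne hbc, ← sum_filter, sum_const, nsmul_eq_mul, mul_zero,
    add_zero, mul_one] at hexpand
  omega

/-- Parseval's identity on the coordinates in `J`. -/
theorem sum_sq_sum_setSign (hF : IsHadamardFamily F) (S J : Finset α) :
    ∑ A ∈ F, (∑ x ∈ J, setSign A x * setSign S x) ^ 2 = #J * #F := by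
  have hcolumn (x : α) (hx : x ∈ J) :
      ∑ y ∈ J, setSign S x * setSign S y * ∑ A ∈ F, setSign A x * setSign A y = #F := by
    rw [sum_eq_single_of_mem x hx, setSign_mul_self, hF.sum_setSign_mul_setSign_self, hF.card_eq]
    · push_cast
      ring
    · intro y _ hyx
      rw [hF.sum_setSign_mul_setSign_of_ne hyx.symm, mul_zero]
  calc ∑ A ∈ F, (∑ x ∈ J, setSign A x * setSign S x) ^ 2
      = ∑ A ∈ F, ∑ x ∈ J, ∑ y ∈ J, setSign S x * setSign S y * (setSign A x * setSign A y) := by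
        simp only [sq, sum_mul_sum, mul_comm, mul_left_comm]
    _ = ∑ x ∈ J, ∑ y ∈ J, setSign S x * setSign S y * ∑ A ∈ F, setSign A x * setSign A y := by
        simp only [mul_sum]
        rw [sum_comm]
        exact sum_congr rfl fun x _ => sum_comm
    _ = #J * #F := by rw [sum_congr rfl hcolumn, sum_const, nsmul_eq_mul]

/-- The Norse bound. -/
theorem exists_card_le_sq [Nonempty α] (hF : IsHadamardFamily F) (S J : Finset α) :
    ∃ A ∈ F, 2 * #((A ∆ S) ∩ J) ≤ #J ∧ (#J : ℤ) ≤ (#J - 2 * #((A ∆ S) ∩ J)) ^ 2 := by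
  have hne : F.Nonempty := by
    rw [← card_pos, hF.card_eq]
    exact Nat.mul_pos two_pos Fintype.card_pos
  obtain ⟨A, hA, hle⟩ := exists_le_of_sum_le hne
    (by rw [hF.sum_sq_sum_setSign S J, sum_const, nsmul_eq_mul, mul_comm] :
      ∑ _A ∈ F, (#J : ℤ) ≤ ∑ A ∈ F, (∑ x ∈ J, setSign A x * setSign S x) ^ 2)
  rcases le_total 0 (∑ x ∈ J, setSign A x * setSign S x) with h | h
  · rw [sum_setSign_mul_setSign] at hle h
    exact ⟨A, hA, by omega, hle⟩
  · have hneg : ∑ x ∈ J, setSign Aᶜ x * setSign S x = -∑ x ∈ J, setSign A x * setSign S x := by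
      simp only [setSign_compl, neg_mul, sum_neg_distrib]
    rw [← neg_sq, ← hneg, sum_setSign_mul_setSign] at hle
    rw [← neg_nonneg, ← hneg, sum_setSign_mul_setSign] at h
    exact ⟨Aᶜ, hF.compl_mem A hA, by omega, hle⟩

theorem univ_mem (hF : IsHadamardFamily F) (h0 : ∅ ∈ F) : univ ∈ F := by
  simpa using hF.compl_mem ∅ h0

theorem eq_empty_or_two_mul_card_or_eq_univ (hF : IsHadamardFamily F) (h0 : ∅ ∈ F) {A : Finset α}
    (hA : A ∈ F) : A = ∅ ∨ 2 * #A = Fintype.card α ∨ A = univ := by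
  have hcases := hF.card_symmDiff A hA ∅ h0
  rwa [← bot_eq_empty, symmDiff_bot, card_eq_zero, card_eq_iff_eq_univ] at hcases

theorem four_mul_card_inter_eq (hF : IsHadamardFamily F) {A B : Finset α} (hA : A ∈ F) (hB : B ∈ F)
    (hA2 : 2 * #A = Fintype.card α) (hB2 : 2 * #B = Fintype.card α) (hne : A ≠ B)
    (hAB : (A ∩ B).Nonempty) : 4 * #(A ∩ B) = Fintype.card α := by
  have hcard := card_symmDiff_add_two_mul_card_inter A B
  have hpos := card_pos.2 hAB
  rcases hF.card_symmDiff A hA B hB with h | h | h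
  · exact absurd (eq_of_card_symmDiff_eq_zero h) hne
  all_goals omega

theorem exists_inter_eq (hF : IsHadamardFamily F) (h0 : ∅ ∈ F) (hα : Fintype.card α = 12)
    {T : Finset α} (hT : #T = 3) :
    ∃ A ∈ F, ∃ B ∈ F, #A = 6 ∧ #B = 6 ∧ A ∩ B = T ∧
      ∀ D ∈ F, T ⊆ D → D = A ∨ D = B ∨ D = univ := by
  have hthree : #{A ∈ F | T ⊆ A} = 3 := by
    have hcount := hF.eight_mul_card_inter_eq hT subset_rfl
    simp only [inter_eq_right, hF.card_eq, hα] at hcount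
    omega
  have huniv : univ ∈ ({A ∈ F | T ⊆ A} : Finset (Finset α)) :=
    mem_filter.2 ⟨hF.univ_mem h0, subset_univ T⟩
  obtain ⟨A, B, hAB, herase⟩ := card_eq_two.1 ((card_erase_of_mem huniv).trans (by rw [hthree]))
  have hmem (D : Finset α) : (D ≠ univ ∧ D ∈ F ∧ T ⊆ D) ↔ D = A ∨ D = B := by
    rw [← mem_filter, ← mem_erase, herase, mem_insert, mem_singleton]
  have hsix {D : Finset α} (hD : D ≠ univ ∧ D ∈ F ∧ T ⊆ D) : #D = 6 := by
    rcases hF.eq_empty_or_two_mul_card_or_eq_univ h0 hD.2.1 with rfl | h | h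
    · rw [subset_empty.1 hD.2.2, card_empty] at hT
      omega
    · omega
    · exact absurd h hD.1
  have hA := (hmem A).2 (.inl rfl)
  have hB := (hmem B).2 (.inr rfl)
  have hTAB : T ⊆ A ∩ B := subset_inter hA.2.2 hB.2.2
  have hinter := hF.four_mul_card_inter_eq hA.2.1 hB.2.1 (by rw [hsix hA, hα])
    (by rw [hsix hB, hα]) hAB ((card_pos.1 (by omega)).mono hTAB)
  refine ⟨A, hA.2.1, B, hB.2.1, hsix hA, hsix hB,
    (eq_of_subset_of_card_le hTAB (by omega)).symm, fun D hD hTD => ?_⟩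
  by_cases hDu : D = univ
  · exact .inr (.inr hDu)
  · exact ((hmem D).1 ⟨hDu, hD, hTD⟩).imp_right .inl

end IsHadamardFamily

end HadamardFamily

section Tetracode

open Finset

/-- The tetracode, the ternary Hamming code of length four. -/
def tetracode : Finset (Fin 4 → Fin 3) :=
  univ.image fun p : Fin 3 × Fin 3 => ![p.1, p.2, p.1 + p.2, p.2 - p.1]

/-- The parameters of the tetracode: `D` has at least nine words, any two of which agree in at most
one of the four entries. -/
structure IsTetracodeLike (D : Finset (Fin 4 → Fin 3)) : Prop where
  nine_le_card : 9 ≤ #D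
  three_le_hammingDist : ∀ c ∈ D, ∀ d ∈ D, c ≠ d → 3 ≤ hammingDist c d

namespace IsTetracodeLike

variable {D : Finset (Fin 4 → Fin 3)}

theorem eq_of_apply_eq (hD : IsTetracodeLike D) {c d : Fin 4 → Fin 3} (hc : c ∈ D) (hd : d ∈ D)
    {i j : Fin 4} (hij : i ≠ j) (hi : c i = d i) (hj : c j = d j) : c = d := by
  by_contra hne
  have hsub : ({n | c n ≠ d n} : Finset (Fin 4)) ⊆ {i, j}ᶜ := by
    intro n hn
    simp only [mem_filter_univ, mem_compl, mem_insert, mem_singleton, not_or] at hn ⊢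
    exact ⟨fun h => hn (h ▸ hi), fun h => hn (h ▸ hj)⟩
  have hle : hammingDist c d ≤ #({i, j}ᶜ : Finset (Fin 4)) := card_le_card hsub
  rw [card_compl, card_pair hij, Fintype.card_fin] at hle
  have := hD.three_le_hammingDist c hc d hd hne
  omega

theorem exists_mem_apply_eq (hD : IsTetracodeLike D) {i j : Fin 4} (hij : i ≠ j) (a b : Fin 3) :
    ∃ c ∈ D, c i = a ∧ c j = b := by
  have hcard : #(D.image fun c => (c i, c j)) = #D :=
    card_image_of_injOn fun c hc d hd h =>
      hD.eq_of_apply_eq hc hd hij (congrArg Prod.fst h) (congrArg Prod.snd h)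
  have himage : D.image (fun c => (c i, c j)) = univ := by
    refine eq_univ_of_card _ (le_antisymm (card_le_univ _) ?_)
    simpa [hcard] using hD.nine_le_card
  obtain ⟨c, hc, h⟩ := mem_image.1 (himage ▸ mem_univ (a, b))
  exact ⟨c, hc, congrArg Prod.fst h, congrArg Prod.snd h⟩

theorem map_piCongrRight (hD : IsTetracodeLike D) (π : Fin 4 → Equiv.Perm (Fin 3)) :
    IsTetracodeLike (D.map (Equiv.piCongrRight π).toEmbedding) where
  nine_le_card := by rw [card_map]; exact hD.nine_le_card
  three_le_hammingDist := by
    simp only [forall_mem_map, ne_eq, EmbeddingLike.apply_eq_iff_eq]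
    intro c hc d hd hne
    exact (hD.three_le_hammingDist c hc d hd hne).trans_eq
      (hammingDist_comp (fun n => π n) fun n => (π n).injective).symm

theorem tetracode_subset (hD : IsTetracodeLike D) (h₀ : ∀ l, ![0, l, l, l] ∈ D)
    (h₁ : ![1, 0, 1, 2] ∈ D) : tetracode ⊆ D := by
  have hdist {c d : Fin 4 → Fin 3} (hc : c ∈ D) (hd : d ∈ D) (h : c 0 ≠ d 0) :
      3 ≤ hammingDist c d := hD.three_le_hammingDist c hc d hd fun hcd => h (hcd ▸ rfl)
  have hrow₁ : ∀ c : Fin 4 → Fin 3, c 0 = 1 → (∀ l, 3 ≤ hammingDist c ![0, l, l, l]) →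
      (c = ![1, 0, 1, 2] ∨ 3 ≤ hammingDist c ![1, 0, 1, 2]) →
      c = ![1, c 1, 1 + c 1, c 1 - 1] := by decide
  have hrow₂ : ∀ c : Fin 4 → Fin 3, c 0 = 2 → (∀ l, 3 ≤ hammingDist c ![0, l, l, l]) →
      (∀ l, 3 ≤ hammingDist c ![1, l, 1 + l, l - 1]) → c = ![2, c 1, 2 + c 1, c 1 - 2] := by
    decide
  have hmem₁ (l : Fin 3) : ![1, l, 1 + l, l - 1] ∈ D := by
    obtain ⟨c, hc, hc0, rfl⟩ := hD.exists_mem_apply_eq (by decide : (0 : Fin 4) ≠ 1) 1 l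
    rwa [← hrow₁ c hc0 (fun l => hdist hc (h₀ l) (by simp [hc0]))
      (or_iff_not_imp_left.2 (hD.three_le_hammingDist c hc _ h₁))]
  have hmem₂ (l : Fin 3) : ![2, l, 2 + l, l - 2] ∈ D := by
    obtain ⟨c, hc, hc0, rfl⟩ := hD.exists_mem_apply_eq (by decide : (0 : Fin 4) ≠ 1) 2 l
    rwa [← hrow₂ c hc0 (fun l => hdist hc (h₀ l) (by simp [hc0]))
      fun l => hdist hc (hmem₁ l) (by simp [hc0])]
  simp only [tetracode, image_subset_iff, mem_univ, true_imp_iff, Prod.forall]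
  intro a b
  match a with
  | 0 => simpa using h₀ b
  | 1 => exact hmem₁ b
  | 2 => exact hmem₂ b

theorem exists_perm_vecCons_mem (hD : IsTetracodeLike D) (a : Fin 3) :
    ∃ σ₁ σ₂ : Equiv.Perm (Fin 3), ∀ l, ![a, σ₁ l, σ₂ l, l] ∈ D := by
  choose w hwD hw0 hw3 using hD.exists_mem_apply_eq (by decide : (0 : Fin 4) ≠ 3) a
  have hinj {n : Fin 4} (hn : 0 ≠ n) : Function.Injective fun l => w l n := fun l l' h => by
    rw [← hw3 l, hD.eq_of_apply_eq (hwD l) (hwD l') hn ((hw0 l).trans (hw0 l').symm) h, hw3]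
  refine ⟨.ofBijective _ (Finite.injective_iff_bijective.1 (hinj (n := 1) (by decide))),
    .ofBijective _ (Finite.injective_iff_bijective.1 (hinj (n := 2) (by decide))), fun l => ?_⟩
  convert hwD l using 1
  ext n
  fin_cases n <;> simp [hw0, hw3]

theorem exists_perm_mem (hD : IsTetracodeLike D) (ρ : Equiv.Perm (Fin 3)) (z : Fin 3) :
    ∃ π : Fin 4 → Equiv.Perm (Fin 3), π 0 = ρ ∧ π 3 0 = z ∧
      ∀ c ∈ tetracode, (fun n => π n (c n)) ∈ D := by
  obtain ⟨σ₁, σ₂, hw⟩ := hD.exists_perm_vecCons_mem (ρ 0)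
  obtain ⟨u, hu, hu0, hu1⟩ := hD.exists_mem_apply_eq (by decide : (0 : Fin 4) ≠ 1) (ρ 1) (σ₁ z)
  have hne {i j : Fin 4} (hij : i ≠ j) {l : Fin 3} (hi : u i = ![ρ 0, σ₁ l, σ₂ l, l] i) :
      u j ≠ ![ρ 0, σ₁ l, σ₂ l, l] j := fun hj => by
    have h01 := hu0.symm.trans (congrFun (hD.eq_of_apply_eq hu (hw l) hij hi hj) 0)
    exact absurd (ρ.injective h01) (by decide)
  obtain ⟨τ, hτ0, hτ2⟩ : ∃ τ : Equiv.Perm (Fin 3), τ 0 = z ∧ τ 2 = u 3 := by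
    have hperm : ∀ a b : Fin 3, b ≠ a → ∃ τ : Equiv.Perm (Fin 3), τ 0 = a ∧ τ 2 = b := by decide
    exact hperm z (u 3) (hne (i := 1) (j := 3) (by decide) hu1)
  have hu2 : u 2 = σ₂ (τ 1) := by
    obtain ⟨l, hl⟩ := (τ.trans σ₂).surjective (u 2)
    have hl0 : l ≠ 0 := by
      rintro rfl
      exact hne (i := 1) (j := 2) (by decide) hu1 (hτ0 ▸ hl.symm)
    have hl2 : l ≠ 2 := by
      rintro rfl
      exact hne (i := 3) (j := 2) (by decide) rfl (hτ2 ▸ hl.symm)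
    obtain rfl : l = 1 := by omega
    exact hl.symm
  set π : Fin 4 → Equiv.Perm (Fin 3) := ![ρ, τ.trans σ₁, τ.trans σ₂, τ] with hπ
  have hmem (c : Fin 4 → Fin 3) : c ∈ D.map (Equiv.piCongrRight fun n => (π n).symm).toEmbedding ↔
      (fun n => π n (c n)) ∈ D := mem_map_equiv
  refine ⟨π, rfl, hτ0, fun c hc => (hmem c).1 ?_⟩
  refine (hD.map_piCongrRight fun n => (π n).symm).tetracode_subset (fun l => ?_) ?_ hc <;>
    rw [hmem]
  · convert hw (τ l) using 1
    ext n
    fin_cases n <;> simp [hπ]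
  · convert hu using 1
    ext n
    fin_cases n <;> simp [hπ, hu0, hu1, hu2, hτ0, hτ2]

end IsTetracodeLike

end Tetracode

section Coordinates

open Finset symmDiff
open scoped FinsetFamily

theorem exists_prod_fin_equiv {α ι : Type*} [Fintype α] [DecidableEq ι] {n : ℕ} (f : α → ι)
    (hf : ∀ i, #{a | f a = i} = n) : ∃ e : ι × Fin n ≃ α, ∀ p, f (e p) = p.1 := by
  have hfiber (i : ι) : Fintype.card {a // f a = i} = n := by rw [Fintype.card_subtype, hf]
  let g (i : ι) : Fin n ≃ {a // f a = i} := (Fintype.equivFinOfCardEq (hfiber i)).symm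
  exact ⟨(Equiv.sigmaEquivProd ι (Fin n)).symm.trans
    ((Equiv.sigmaCongrRight g).trans (Equiv.sigmaFiberEquiv f)), fun p => (g p.1 p.2).2⟩

theorem map_equiv_compl {α β : Type*} [Fintype α] [DecidableEq α] [Fintype β] [DecidableEq β]
    (e : α ≃ β) (A : Finset α) : Aᶜ.map e.toEmbedding = (A.map e.toEmbedding)ᶜ := by
  ext
  simp only [mem_map_equiv, mem_compl]

theorem map_equiv_symmDiff {α β : Type*} [DecidableEq α] [DecidableEq β] (e : α ≃ β)
    (A B : Finset α) : (A ∆ B).map e.toEmbedding = A.map e.toEmbedding ∆ B.map e.toEmbedding := by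
  ext
  simp only [mem_map_equiv, mem_symmDiff]

theorem IsHadamardFamily.map {α β : Type*} [Fintype α] [DecidableEq α] [Fintype β] [DecidableEq β]
    {F : Finset (Finset α)} (hF : IsHadamardFamily F) (e : α ≃ β) :
    IsHadamardFamily (F.map e.finsetCongr.toEmbedding) where
  card_eq := by rw [card_map, hF.card_eq, Fintype.card_congr e]
  compl_mem := by
    simp only [forall_mem_map, Equiv.coe_toEmbedding, Equiv.finsetCongr_apply, ← map_equiv_compl]
    exact fun A hA => mem_map_of_mem e.finsetCongr.toEmbedding (hF.compl_mem A hA)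
  card_symmDiff := by
    simp only [forall_mem_map, Equiv.coe_toEmbedding, Equiv.finsetCongr_apply, ← map_equiv_symmDiff,
      card_map, ← Fintype.card_congr e]
    exact hF.card_symmDiff

/-- The block of points of the `4 × 3` grid attached to a word `c` of length four: the point
`(n, c n)` of the columns `n = 0, 3`, and the other two points of the columns `n = 1, 2`. -/
def wordBlock (c : Fin 4 → Fin 3) : Finset (Fin 4 × Fin 3) :=
  {x | x.2 = c x.1 ↔ x.1 = 0 ∨ x.1 = 3}

theorem mem_wordBlock {c : Fin 4 → Fin 3} {x : Fin 4 × Fin 3} :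
    x ∈ wordBlock c ↔ (x.2 = c x.1 ↔ x.1 = 0 ∨ x.1 = 3) :=
  mem_filter_univ x

theorem card_wordBlock_symmDiff (c d : Fin 4 → Fin 3) :
    #(wordBlock c ∆ wordBlock d) = 2 * hammingDist c d := by
  have hcol : wordBlock c ∆ wordBlock d =
      ({n | c n ≠ d n} : Finset (Fin 4)).biUnion fun n => {(n, c n), (n, d n)} := by
    ext ⟨n, l⟩
    simp only [mem_symmDiff, mem_wordBlock, mem_biUnion, mem_filter_univ, mem_insert,
      mem_singleton, Prod.mk.injEq]
    grind
  have hdisj : ∀ n ∈ ({n | c n ≠ d n} : Finset (Fin 4)), ∀ n' ∈ ({n | c n ≠ d n} : Finset (Fin 4)),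
      n ≠ n' → Disjoint {(n, c n), (n, d n)} ({(n', c n'), (n', d n')} : Finset _) := by
    intro n _ n' _ hne
    simp [hne.symm]
  have hpair : ∀ n ∈ ({n | c n ≠ d n} : Finset (Fin 4)),
      #({(n, c n), (n, d n)} : Finset (Fin 4 × Fin 3)) = 2 := fun n hn =>
    card_pair fun h => (mem_filter_univ n).1 hn (congrArg Prod.snd h)
  rw [hcol, card_biUnion hdisj, sum_congr rfl hpair, sum_const, smul_eq_mul, mul_comm]
  rfl

/-- The Hadamard family on the `4 × 3` grid built from the tetracode. -/
def tetracodeFamily : Finset (Finset (Fin 4 × Fin 3)) :=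
  let 𝓖 := {∅, {0, 1} ×ˢ univ, {0, 2} ×ˢ univ} ∪ tetracode.image wordBlock
  𝓖 ∪ 𝓖ᶜˢ

theorem card_tetracodeFamily : #tetracodeFamily = 24 := by decide +kernel

theorem tetracodeFamily_map_subset {α : Type*} [Fintype α] [DecidableEq α] {F : Finset (Finset α)}
    (hF : IsHadamardFamily F) (h0 : ∅ ∈ F) (e : Fin 4 × Fin 3 ≃ α)
    (h₁ : ({0, 1} ×ˢ univ : Finset (Fin 4 × Fin 3)).map e.toEmbedding ∈ F)
    (h₂ : ({0, 2} ×ˢ univ : Finset (Fin 4 × Fin 3)).map e.toEmbedding ∈ F)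
    (hc : ∀ c ∈ tetracode, (wordBlock c).map e.toEmbedding ∈ F) :
    tetracodeFamily.map e.finsetCongr.toEmbedding ⊆ F := by
  have hgen : ∀ B ∈ ({∅, {0, 1} ×ˢ univ, {0, 2} ×ˢ univ} ∪ tetracode.image wordBlock :
      Finset (Finset (Fin 4 × Fin 3))), B.map e.toEmbedding ∈ F := by
    simpa [or_imp, forall_and, h0, h₁, h₂] using hc
  intro A hA
  obtain ⟨B, hB, rfl⟩ := mem_map.1 hA
  rcases mem_union.1 hB with hB | hB
  · exact hgen B hB
  · simpa [map_equiv_compl] using hF.compl_mem _ (hgen Bᶜ (mem_compls.1 hB))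

theorem card_inter_product_univ {ι κ : Type*} [Fintype κ] [DecidableEq ι] [DecidableEq κ]
    (D : Finset (ι × κ)) (s : Finset ι) :
    #(D ∩ s ×ˢ univ) = ∑ n ∈ s, #{l | (n, l) ∈ D} := by
  simp only [inter_comm D, ← filter_mem_eq_inter, card_filter, sum_product]

theorem exists_wordBlock_eq_of_card_column {D : Finset (Fin 4 × Fin 3)} (hout : ∀ n, n = 0 ∨ n = 3 →
    #{l | (n, l) ∈ D} = 1) (hin : ∀ n, n = 1 ∨ n = 2 → #{l | (n, l) ∈ D} = 2) :
    ∃ c, wordBlock c = D := by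
  have hcol (n : Fin 4) : ∃ l, ∀ l', (n, l') ∈ D ↔ (l' = l ↔ n = 0 ∨ n = 3) := by
    by_cases hn : n = 0 ∨ n = 3
    · obtain ⟨l, hl⟩ := card_eq_one.1 (hout n hn)
      exact ⟨l, fun l' => by simpa [hn] using Finset.ext_iff.1 hl l'⟩
    · have hcompl : #({l | (n, l) ∈ D} : Finset (Fin 3))ᶜ = 1 := by
        rw [card_compl, hin n (by omega), Fintype.card_fin]
      obtain ⟨l, hl⟩ := card_eq_one.1 hcompl
      refine ⟨l, fun l' => ?_⟩
      have := Finset.ext_iff.1 hl l'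
      simp only [mem_compl, mem_filter_univ, mem_singleton] at this
      tauto
  choose c hc using hcol
  exact ⟨c, ext fun x => mem_wordBlock.trans (hc x.1 x.2).symm⟩

namespace IsHadamardFamily

section Grid

variable {G : Finset (Finset (Fin 4 × Fin 3))}

theorem exists_wordBlock_eq (hG : IsHadamardFamily G) (h0 : ∅ ∈ G) (h₁ : {0, 1} ×ˢ univ ∈ G)
    (h₂ : {0, 2} ×ˢ univ ∈ G) {D : Finset (Fin 4 × Fin 3)} (hD : D ∈ G)
    (htrace : #(D ∩ {0} ×ˢ univ) = 1) : ∃ c, wordBlock c = D := by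
  have hcard : 2 * #D = 12 := by
    rcases hG.eq_empty_or_two_mul_card_or_eq_univ h0 hD with rfl | h | rfl
    · simp at htrace
    · simpa using h
    · simp at htrace
  have hinter {n : Fin 4} (hn : n ≠ 0) (hmem : {0, n} ×ˢ univ ∈ G) :
      #(D ∩ {0, n} ×ˢ univ) = 3 := by
    have hsub : D ∩ {0} ×ˢ univ ⊆ D ∩ {0, n} ×ˢ univ :=
      inter_subset_inter_left (product_subset_product_left (by simp))
    have hne : D ≠ {0, n} ×ˢ univ := by
      rintro rfl
      rw [inter_eq_right.2 (product_subset_product_left (by simp))] at htrace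
      simp at htrace
    have := hG.four_mul_card_inter_eq hD hmem (by simpa using hcard)
      (by simp [card_pair hn.symm]) hne ((card_pos.1 (by omega)).mono hsub)
    simp only [Fintype.card_prod, Fintype.card_fin] at this
    omega
  have htotal := card_inter_product_univ D univ
  have h01 := hinter (n := 1) (by decide) h₁
  have h02 := hinter (n := 2) (by decide) h₂
  rw [univ_product_univ, inter_univ, Fin.sum_univ_four] at htotal
  rw [card_inter_product_univ, sum_pair (by decide)] at h01 h02
  rw [card_inter_product_univ, sum_singleton] at htrace
  exact exists_wordBlock_eq_of_card_column (by rintro n (rfl | rfl) <;> omega)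
    (by rintro n (rfl | rfl) <;> omega)

theorem isTetracodeLike (hG : IsHadamardFamily G) (h0 : ∅ ∈ G) (h₁ : {0, 1} ×ˢ univ ∈ G)
    (h₂ : {0, 2} ×ˢ univ ∈ G) : IsTetracodeLike {c | wordBlock c ∈ G} where
  nine_le_card := by
    set T : Finset (Fin 4 × Fin 3) := {0} ×ˢ univ with hT
    have hT3 : #T = 3 := by simp [hT]
    have htrace : ∀ P ∈ powersetCard 1 T, #{D ∈ {D ∈ G | #(D ∩ T) = 1} | D ∩ T = P} = 3 := by
      intro P hP
      obtain ⟨hPT, hP⟩ := mem_powersetCard.1 hP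
      have hcount := hG.eight_mul_card_inter_eq hT3 hPT
      rw [hG.card_eq, Fintype.card_prod, Fintype.card_fin, Fintype.card_fin] at hcount
      rw [filter_filter, filter_congr fun D _ => and_iff_right_of_imp fun h => h ▸ hP]
      omega
    have hnine : #{D ∈ G | #(D ∩ T) = 1} = 9 := by
      rw [card_eq_sum_card_fiberwise (f := (· ∩ T)) (t := powersetCard 1 T) fun D hD =>
        mem_powersetCard.2 ⟨inter_subset_right, (mem_filter.1 hD).2⟩, sum_congr rfl htrace,
        sum_const, card_powersetCard, hT3]
      rfl
    rw [← hnine]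
    refine le_trans (card_le_card fun D hD => ?_) (card_image_le (f := wordBlock))
    obtain ⟨hD, hDT⟩ := mem_filter.1 hD
    obtain ⟨c, rfl⟩ := hG.exists_wordBlock_eq h0 h₁ h₂ hD hDT
    exact mem_image_of_mem wordBlock ((mem_filter_univ c).2 hD)
  three_le_hammingDist c hc d hd hne := by
    rw [mem_filter_univ] at hc hd
    have hcases := hG.card_symmDiff _ hc _ hd
    have hpos := hammingDist_pos.2 hne
    simp only [card_wordBlock_symmDiff, Fintype.card_prod, Fintype.card_fin] at hcases
    omega

end Grid

end IsHadamardFamily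

end Coordinates

section Identification

open Finset

theorem map_finsetCongr_trans {α β γ : Type*} (F : Finset (Finset α)) (e : α ≃ β) (e' : β ≃ γ) :
    F.map (e.trans e').finsetCongr.toEmbedding =
      (F.map e.finsetCongr.toEmbedding).map e'.finsetCongr.toEmbedding := by
  rw [← Equiv.finsetCongr_trans, map_map]
  rfl

theorem map_finsetCongr_map_symm {α β : Type*} (F : Finset (Finset α)) (e : α ≃ β) :
    (F.map e.finsetCongr.toEmbedding).map e.symm.finsetCongr.toEmbedding = F := by
  rw [← map_finsetCongr_trans, Equiv.self_trans_symm, Equiv.finsetCongr_refl]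
  exact map_refl

theorem IsHadamardFamily.exists_perm_map_tetracodeFamily_eq {G : Finset (Finset (Fin 4 × Fin 3))}
    (hG : IsHadamardFamily G) (h0 : ∅ ∈ G) (h₁ : {0, 1} ×ˢ univ ∈ G) (h₂ : {0, 2} ×ˢ univ ∈ G)
    (ρ : Equiv.Perm (Fin 3)) (z : Fin 3) :
    ∃ π : Fin 4 → Equiv.Perm (Fin 3), π 0 = ρ ∧ π 3 0 = z ∧
      tetracodeFamily.map (Equiv.prodShear (Equiv.refl _) π).finsetCongr.toEmbedding = G := by
  obtain ⟨π, h0ρ, h3z, hπ⟩ := (hG.isTetracodeLike h0 h₁ h₂).exists_perm_mem ρ z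
  refine ⟨π, h0ρ, h3z, ?_⟩
  have hcolumn (s : Finset (Fin 4)) :
      (s ×ˢ univ).map (Equiv.prodShear (Equiv.refl _) π).toEmbedding = s ×ˢ univ := by
    ext
    simp only [mem_map_equiv, mem_product, mem_univ, and_true]
    rfl
  have hword (c : Fin 4 → Fin 3) :
      (wordBlock c).map (Equiv.prodShear (Equiv.refl _) π).toEmbedding =
        wordBlock fun n => π n (c n) := by
    ext x
    simp only [mem_map_equiv, mem_wordBlock, ← Equiv.symm_apply_eq]
    rfl
  have hsub := tetracodeFamily_map_subset hG h0 (Equiv.prodShear (Equiv.refl _) π)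
    (by rwa [hcolumn]) (by rwa [hcolumn]) fun c hc => by
      rw [hword]
      exact (mem_filter_univ (p := fun c => wordBlock c ∈ G) _).1 (hπ c hc)
  refine eq_of_subset_of_card_le hsub ?_
  rw [card_map, card_tetracodeFamily, hG.card_eq]
  rfl

theorem exists_grid_equiv_of_card {α : Type*} [Fintype α] [DecidableEq α] (hα : Fintype.card α = 12)
    {A B : Finset α} (hA : #A = 6) (hB : #B = 6) (hAB : #(A ∩ B) = 3) :
    ∃ e : Fin 4 × Fin 3 ≃ α, (∀ p, e p ∈ A ↔ p.1 = 0 ∨ p.1 = 1) ∧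
      ∀ p, e p ∈ B ↔ p.1 = 0 ∨ p.1 = 2 := by
  let f (a : α) : Fin 4 := if a ∈ A then if a ∈ B then 0 else 1 else if a ∈ B then 2 else 3
  have hfA (a : α) : a ∈ A ↔ f a = 0 ∨ f a = 1 := by dsimp only [f]; split_ifs <;> simp_all
  have hfB (a : α) : a ∈ B ↔ f a = 0 ∨ f a = 2 := by dsimp only [f]; split_ifs <;> simp_all
  have hfiber (i : Fin 4) : ({a | f a = i} : Finset α) = ![A ∩ B, A \ B, B \ A, (A ∪ B)ᶜ] i := by
    ext a
    fin_cases i <;> simp [hfA, hfB] <;> omega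
  have hsdA := card_sdiff_add_card_inter A B
  have hsdB := card_sdiff_add_card_inter B A
  have hun := card_union_add_card_inter A B
  have hcompl := card_add_card_compl (A ∪ B)
  rw [inter_comm] at hsdB
  obtain ⟨e, he⟩ := exists_prod_fin_equiv (n := 3) f fun i => by
    rw [hfiber]
    fin_cases i <;> simp only [Fin.reduceFinMk, Matrix.cons_val] <;> omega
  exact ⟨e, fun p => by rw [hfA, he], fun p => by rw [hfB, he]⟩

namespace IsHadamardFamily

variable {α : Type*} [Fintype α] [DecidableEq α] {F : Finset (Finset α)}

theorem exists_grid_equiv (hF : IsHadamardFamily F) (h0 : ∅ ∈ F) (hα : Fintype.card α = 12)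
    {v : Fin 4 → α} (hv : Function.Injective v) (hspan : ∀ B ∈ F, (∀ i, v i ∈ B) → B = univ) :
    ∃ e : Fin 4 × Fin 3 ≃ α,
      {0, 1} ×ˢ univ ∈ F.map e.symm.finsetCongr.toEmbedding ∧
      {0, 2} ×ˢ univ ∈ F.map e.symm.finsetCongr.toEmbedding ∧
      (∀ l : Fin 3, (e.symm (v l.castSucc)).1 = 0) ∧ (e.symm (v (Fin.last 3))).1 = 3 := by
  have hT : #(univ.image (v ∘ Fin.castSucc)) = 3 := by
    rw [card_image_of_injective _ (hv.comp (Fin.castSucc_injective 3)), card_univ, Fintype.card_fin]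
  obtain ⟨A, hA, B, hB, hA6, hB6, hAB, -⟩ := hF.exists_inter_eq h0 hα hT
  have hfirst (l : Fin 3) : v l.castSucc ∈ A ∧ v l.castSucc ∈ B := by
    rw [← mem_inter, hAB]
    exact mem_image_of_mem (v ∘ Fin.castSucc) (mem_univ l)
  have hlast {D : Finset α} (hD : D ∈ F) (hD6 : #D = 6) (hsub : ∀ l : Fin 3, v l.castSucc ∈ D) :
      v (Fin.last 3) ∉ D := fun hlast => by
    rw [hspan D hD (Fin.lastCases hlast hsub), card_univ, hα] at hD6
    omega
  obtain ⟨e, heA, heB⟩ := exists_grid_equiv_of_card hα hA6 hB6 (hAB ▸ hT)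
  have hmap {D : Finset α} (hD : D ∈ F) {n : Fin 4} (he : ∀ p, e p ∈ D ↔ p.1 = 0 ∨ p.1 = n) :
      {0, n} ×ˢ univ ∈ F.map e.symm.finsetCongr.toEmbedding :=
    mem_map.2 ⟨D, hD, by ext p; simp [mem_map_equiv, he]⟩
  refine ⟨e, hmap hA heA, hmap hB heB, fun l => ?_, ?_⟩
  · have hrowA := heA (e.symm (v l.castSucc))
    have hrowB := heB (e.symm (v l.castSucc))
    simp only [Equiv.apply_symm_apply, hfirst, true_iff] at hrowA hrowB
    omega
  · have hrowA := heA (e.symm (v (Fin.last 3)))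
    have hrowB := heB (e.symm (v (Fin.last 3)))
    simp only [Equiv.apply_symm_apply, hlast hA hA6 fun l => (hfirst l).1,
      hlast hB hB6 fun l => (hfirst l).2, false_iff] at hrowA hrowB
    omega

theorem exists_equiv_map_tetracodeFamily_eq (hF : IsHadamardFamily F) (h0 : ∅ ∈ F)
    (hα : Fintype.card α = 12) {v : Fin 4 → α} (hv : Function.Injective v)
    (hspan : ∀ B ∈ F, (∀ i, v i ∈ B) → B = univ) :
    ∃ e : Fin 4 × Fin 3 ≃ α, tetracodeFamily.map e.finsetCongr.toEmbedding = F ∧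
      (∀ l : Fin 3, e (0, l) = v l.castSucc) ∧ e (3, 0) = v (Fin.last 3) := by
  obtain ⟨e, h₁, h₂, hfirst, hlast⟩ := hF.exists_grid_equiv h0 hα hv hspan
  have hinj : Function.Injective fun l : Fin 3 => (e.symm (v l.castSucc)).2 := fun l l' h =>
    Fin.castSucc_injective 3 <| hv <| e.symm.injective <|
      Prod.ext ((hfirst l).trans (hfirst l').symm) h
  obtain ⟨π, hπ0, hπ3, hπ⟩ := (hF.map e.symm).exists_perm_map_tetracodeFamily_eq
    (mem_map.2 ⟨∅, h0, rfl⟩) h₁ h₂ (Equiv.ofBijective _ (Finite.injective_iff_bijective.1 hinj))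
    (e.symm (v (Fin.last 3))).2
  refine ⟨(Equiv.prodShear (Equiv.refl _) π).trans e, ?_, fun l => ?_, ?_⟩
  · rw [map_finsetCongr_trans, hπ]
    exact map_finsetCongr_map_symm F e.symm
  · exact (Equiv.eq_symm_apply e).1
      (Prod.ext (hfirst l).symm (congrArg (fun τ : Equiv.Perm (Fin 3) => τ l) hπ0))
  · exact (Equiv.eq_symm_apply e).1 (Prod.ext hlast.symm hπ3)

end IsHadamardFamily

end Identification

section Matching

open Finset symmDiff

-- The summand `1` in `hS` makes room for the deleted entry of a punctured code.
theorem IsHadamardFamily.exists_superset_card_eq_four {α : Type*} [Fintype α] [DecidableEq α]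
    {F : Finset (Finset α)} (hF : IsHadamardFamily F) (h0 : ∅ ∈ F) (hα : Fintype.card α = 12)
    {S : Finset α} (hS4 : #S ≤ 4) (hS : ∀ B ∈ F, #S ≤ #(S ∆ B) + 1) :
    ∃ R, S ⊆ R ∧ #R = 4 ∧ ∀ B ∈ F, R ⊆ B → B = univ := by
  rcases hS4.eq_or_lt with hS4 | hS3
  · refine ⟨S, Subset.rfl, hS4, fun B hB hSB => ?_⟩
    have hcard := card_symmDiff_add_two_mul_card_inter S B
    have hclose := hS B hB
    rw [inter_eq_left.2 hSB] at hcard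
    rcases hF.eq_empty_or_two_mul_card_or_eq_univ h0 hB with rfl | hB6 | rfl
    · simp [subset_empty.1 hSB] at hS4
    · omega
    · rfl
  · obtain ⟨T, hST, hT⟩ : ∃ T, S ⊆ T ∧ #T = 3 := by
      obtain ⟨T, hST, -, hT⟩ := exists_subsuperset_card_eq (subset_univ S)
        (Nat.lt_succ_iff.1 hS3) (by rw [card_univ, hα]; norm_num)
      exact ⟨T, hST, hT⟩
    obtain ⟨A, -, B, -, hA, hB, hAB, hunique⟩ := hF.exists_inter_eq h0 hα hT
    have hunion := card_union_add_card_inter A B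
    rw [hAB] at hunion
    obtain ⟨x, -, hx⟩ : ∃ x ∈ univ, x ∉ A ∪ B :=
      exists_mem_notMem_of_card_lt_card (by rw [card_univ, hα]; omega)
    obtain ⟨hxA, hxB⟩ := notMem_union.1 hx
    have hxT : x ∉ T := fun h => hxA (inter_subset_left (hAB ▸ h))
    refine ⟨insert x T, hST.trans (subset_insert x T), by rw [card_insert_of_notMem hxT, hT],
      fun D hD hRD => ?_⟩
    obtain ⟨hxD, hTD⟩ := insert_subset_iff.1 hRD
    rcases hunique D hD hTD with rfl | rfl | rfl
    · exact absurd hxD hxA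
    · exact absurd hxD hxB
    · rfl

theorem exists_perm_map_eq_and_apply_eq {ι : Type*} [Finite ι]
    {Q Q' : Finset ι} (hQ : #Q = #Q') {i i' : ι} (hi : i ∈ Q) (hi' : i' ∈ Q') :
    ∃ τ : Equiv.Perm ι, Q.map τ.toEmbedding = Q' ∧ τ i = i' := by
  classical
  let e := equivOfCardEq hQ
  have he : ∀ x ∈ Q, e.extendSubtype x ∈ Q' := fun x hx => e.extendSubtype_mem x hx
  let τ := e.extendSubtype.trans (Equiv.swap (e.extendSubtype i) i')
  have hτ : ∀ x ∈ Q, τ x ∈ Q' := fun x hx => by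
    rcases eq_or_ne (e.extendSubtype x) (e.extendSubtype i) with h | h
    · simpa [τ, h] using hi'
    · rcases eq_or_ne (e.extendSubtype x) i' with h' | h'
      · simpa [τ, h'] using he i hi
      · simpa [τ, Equiv.swap_apply_of_ne_of_ne h h'] using he x hx
  refine ⟨τ, eq_of_subset_of_card_le (fun y hy => ?_) (by rw [card_map, hQ]), by simp [τ]⟩
  obtain ⟨x, hx, rfl⟩ := mem_map.1 hy
  exact hτ x hx

theorem IsHadamardFamily.exists_equiv_map_eq {α β : Type*} [Fintype α] [DecidableEq α] [Fintype β]
    [DecidableEq β] {F : Finset (Finset α)} {F' : Finset (Finset β)} (hF : IsHadamardFamily F)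
    (hF' : IsHadamardFamily F') (h0 : ∅ ∈ F) (h0' : ∅ ∈ F') (hα : Fintype.card α = 12)
    (hβ : Fintype.card β = 12) {v : Fin 4 → α} {v' : Fin 4 → β} (hv : Function.Injective v)
    (hv' : Function.Injective v') (hspan : ∀ B ∈ F, (∀ i, v i ∈ B) → B = univ)
    (hspan' : ∀ B ∈ F', (∀ i, v' i ∈ B) → B = univ) :
    ∃ σ : α ≃ β, F.map σ.finsetCongr.toEmbedding = F' ∧ ∀ i, σ (v i) = v' i := by
  obtain ⟨e, he, hfirst, hlast⟩ := hF.exists_equiv_map_tetracodeFamily_eq h0 hα hv hspan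
  obtain ⟨e', he', hfirst', hlast'⟩ := hF'.exists_equiv_map_tetracodeFamily_eq h0' hβ hv' hspan'
  refine ⟨e.symm.trans e', ?_, Fin.lastCases ?_ fun l => ?_⟩
  · rw [map_finsetCongr_trans, ← he, map_finsetCongr_map_symm, he']
  · rw [← hlast, Equiv.trans_apply, Equiv.symm_apply_apply, hlast']
  · rw [← hfirst, Equiv.trans_apply, Equiv.symm_apply_apply, hfirst']

theorem exists_fin_embedding_map_eq {α : Type*} {n : ℕ} {R : Finset α} (hR : #R = n) :
    ∃ v : Fin n ↪ α, univ.map v = R := by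
  refine ⟨(R.equivFinOfCardEq hR).symm.toEmbedding.trans (Function.Embedding.subtype _), ?_⟩
  rw [← map_map, map_univ_equiv]
  ext
  simp

theorem IsHadamardFamily.exists_equiv_map_eq_of_card_eq {α β : Type*} [Fintype α] [DecidableEq α]
    [Fintype β] [DecidableEq β] {F : Finset (Finset α)} {F' : Finset (Finset β)}
    (hF : IsHadamardFamily F) (hF' : IsHadamardFamily F') (h0 : ∅ ∈ F) (h0' : ∅ ∈ F')
    (hα : Fintype.card α = 12) (hβ : Fintype.card β = 12) {S : Finset α} {S' : Finset β}
    (hcard : #S = #S') (hS4 : #S ≤ 4) (hS : ∀ B ∈ F, #S ≤ #(S ∆ B) + 1)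
    (hS' : ∀ B ∈ F', #S' ≤ #(S' ∆ B) + 1) {a : α} {a' : β} (ha : a ∈ S) (ha' : a' ∈ S') :
    ∃ σ : α ≃ β, F.map σ.finsetCongr.toEmbedding = F' ∧ S.map σ.toEmbedding = S' ∧ σ a = a' := by
  obtain ⟨R, hSR, hR4, hspan⟩ := hF.exists_superset_card_eq_four h0 hα hS4 hS
  obtain ⟨R', hSR', hR4', hspan'⟩ := hF'.exists_superset_card_eq_four h0' hβ (hcard ▸ hS4) hS'
  obtain ⟨v, rfl⟩ := exists_fin_embedding_map_eq hR4
  obtain ⟨v', rfl⟩ := exists_fin_embedding_map_eq hR4'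
  obtain ⟨Q, -, rfl⟩ := subset_map_iff.1 hSR
  obtain ⟨Q', -, rfl⟩ := subset_map_iff.1 hSR'
  obtain ⟨i, hi, rfl⟩ := mem_map.1 ha
  obtain ⟨i', hi', rfl⟩ := mem_map.1 ha'
  obtain ⟨τ, rfl, rfl⟩ := exists_perm_map_eq_and_apply_eq (by simpa using hcard) hi hi'
  obtain ⟨σ, hσ, hσv⟩ := hF.exists_equiv_map_eq hF' h0 h0' hα hβ v.injective
    (v'.injective.comp τ.injective)
    (fun B hB hvB => hspan B hB fun x hx => by
      obtain ⟨j, -, rfl⟩ := mem_map.1 hx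
      exact hvB j)
    (fun B hB hvB => hspan' B hB fun x hx => by
      obtain ⟨j, -, rfl⟩ := mem_map.1 hx
      simpa using hvB (τ.symm j))
  refine ⟨σ, hσ, ?_, hσv i⟩
  rw [map_map, map_map]
  exact congrArg (Q.map ·) (Function.Embedding.ext hσv)

end Matching

section Codes

open Finset symmDiff

variable {m : ℕ}

/-- The set of entries in which two vertices differ. -/
def diffSet (α β : HammingVertex m) : Finset (Fin m) := {i | α i ≠ β i}

theorem mem_diffSet {α β : HammingVertex m} {i : Fin m} : i ∈ diffSet α β ↔ α i ≠ β i :=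
  mem_filter_univ i

theorem card_diffSet (α β : HammingVertex m) : #(diffSet α β) = hammingDist α β := rfl

theorem diffSet_symmDiff (α β γ : HammingVertex m) :
    diffSet α β ∆ diffSet α γ = diffSet β γ := by
  have hbit : ∀ a b c : ZMod 2, (a ≠ b ∧ ¬a ≠ c ∨ a ≠ c ∧ ¬a ≠ b) ↔ b ≠ c := by decide
  ext i
  simpa only [mem_symmDiff, mem_diffSet] using hbit (α i) (β i) (γ i)

theorem card_symmDiff_diffSet (α β γ : HammingVertex m) :
    #(diffSet α β ∆ diffSet α γ) = hammingDist β γ := by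
  rw [diffSet_symmDiff, card_diffSet]

theorem diffSet_injective (α : HammingVertex m) : Function.Injective (diffSet α) := by
  intro β γ h
  rw [← hammingDist_eq_zero, ← card_symmDiff_diffSet α, h, symmDiff_self, bot_eq_empty, card_empty]

theorem diffSet_surjective (α : HammingVertex m) : Function.Surjective (diffSet α) := by
  intro S
  refine ⟨fun i => if i ∈ S then α i + 1 else α i, ?_⟩
  ext i
  by_cases h : i ∈ S <;> simp [mem_diffSet, h]

theorem diffSet_add_one (α β : HammingVertex m) : diffSet α (β + 1) = (diffSet α β)ᶜ := by
  have hbit : ∀ a b : ZMod 2, a ≠ b + 1 ↔ ¬a ≠ b := by decide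
  ext i
  simpa only [mem_compl, mem_diffSet, Pi.add_apply, Pi.one_apply] using hbit (α i) (β i)

theorem hammingDist_add_one_add (α β : HammingVertex m) :
    hammingDist α (β + 1) + hammingDist α β = m := by
  rw [← card_diffSet, diffSet_add_one, ← card_diffSet, card_compl_add_card, Fintype.card_fin]

/-- The supports of the codewords, after translating `α` to zero. -/
def codeFamily (C : BinaryCode m) (α : HammingVertex m) : Finset (Finset (Fin m)) :=
  C.image (diffSet α)

variable {C D : BinaryCode m} {α β γ : HammingVertex m}

theorem mem_codeFamily {B : Finset (Fin m)} : B ∈ codeFamily C α ↔ ∃ β ∈ C, diffSet α β = B :=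
  mem_image

theorem diffSet_mem_codeFamily : diffSet α β ∈ codeFamily C α ↔ β ∈ C :=
  (diffSet_injective α).mem_finset_image

theorem card_codeFamily : #(codeFamily C α) = #C :=
  card_image_of_injective C (diffSet_injective α)

theorem empty_mem_codeFamily (hα : α ∈ C) : ∅ ∈ codeFamily C α := by
  rw [← bot_eq_empty, ← symmDiff_self (diffSet α α), diffSet_symmDiff]
  exact diffSet_mem_codeFamily.2 hα

theorem compl_mem_codeFamily (hone : ∀ α ∈ C, α + 1 ∈ C) {B : Finset (Fin m)}
    (hB : B ∈ codeFamily C α) :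
    Bᶜ ∈ codeFamily C α := by
  obtain ⟨β, hβ, rfl⟩ := mem_codeFamily.1 hB
  rw [← diffSet_add_one]
  exact diffSet_mem_codeFamily.2 (hone β hβ)

theorem card_filter_hammingDist (C : BinaryCode m) (α γ : HammingVertex m) (k : ℕ) :
    #{β ∈ C | hammingDist γ β = k} = #{B ∈ codeFamily C α | #(diffSet α γ ∆ B) = k} := by
  rw [codeFamily, filter_image, card_image_of_injective _ (diffSet_injective α)]
  simp_rw [card_symmDiff_diffSet]

theorem distToCode_le (hα : α ∈ C) (γ : HammingVertex m) : distToCode C γ ≤ hammingDist γ α :=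
  Nat.sInf_le ⟨α, hα, rfl⟩

theorem exists_hammingDist_eq_distToCode (hC : C.Nonempty) (γ : HammingVertex m) :
    ∃ α ∈ C, hammingDist α γ = distToCode C γ := by
  obtain ⟨α, hα⟩ := hC
  simp only [hammingDist_comm _ γ]
  exact Nat.sInf_mem (s := {d : ℕ | ∃ β ∈ C, hammingDist γ β = d}) ⟨_, α, hα, rfl⟩

theorem le_distToCode (hC : C.Nonempty) {n : ℕ} :
    n ≤ distToCode C γ ↔ ∀ β ∈ C, n ≤ hammingDist γ β := by
  refine ⟨fun h β hβ => h.trans (distToCode_le hβ γ), fun h => ?_⟩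
  obtain ⟨α, hα, hdist⟩ := exists_hammingDist_eq_distToCode hC γ
  rw [← hdist, hammingDist_comm]
  exact h α hα

theorem distToCode_eq_zero_iff (hC : C.Nonempty) : distToCode C γ = 0 ↔ γ ∈ C := by
  refine ⟨fun h => ?_, fun h => ?_⟩
  · obtain ⟨α, hα, hdist⟩ := exists_hammingDist_eq_distToCode hC γ
    rwa [← hammingDist_eq_zero.1 (hdist.trans h)]
  · simpa using distToCode_le h γ

theorem card_diffSet_le_card_symmDiff (h : hammingDist α γ = distToCode C γ)
    {B : Finset (Fin m)} (hB : B ∈ codeFamily C α) : #(diffSet α γ) ≤ #(diffSet α γ ∆ B) := by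
  obtain ⟨β, hβ, rfl⟩ := mem_codeFamily.1 hB
  rw [card_symmDiff_diffSet, card_diffSet, h]
  exact distToCode_le hβ γ

theorem exists_distToCode_eq (hC : C.Nonempty) {i : ℕ} (hi : i ≤ coveringRadius C) :
    ∃ γ, distToCode C γ = i := by
  obtain ⟨γ, -, hγ⟩ := exists_mem_eq_sup univ univ_nonempty (distToCode C)
  obtain ⟨α, hα, hdist⟩ := exists_hammingDist_eq_distToCode hC γ
  rw [coveringRadius, hγ, ← hdist, ← card_diffSet] at hi
  obtain ⟨S, hS, rfl⟩ := exists_subset_card_eq hi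
  obtain ⟨η, rfl⟩ := diffSet_surjective α S
  have hsplit : hammingDist γ η + hammingDist α η = hammingDist α γ := by
    rw [← card_symmDiff_diffSet α, symmDiff_of_ge hS, ← card_diffSet, ← card_diffSet]
    exact card_sdiff_add_card_eq_card hS
  refine ⟨η, le_antisymm ?_ ((le_distToCode hC).2 fun β hβ => ?_)⟩
  · rw [card_diffSet, hammingDist_comm]
    exact distToCode_le hα η
  · have hle := distToCode_le hβ γ
    have htri := hammingDist_triangle γ η β
    rw [card_diffSet]
    omega

/-- The automorphism of `H(m,2)` permuting the entries by `σ` and then translating by `t`. -/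
def affineAut (σ : Equiv.Perm (Fin m)) (t : HammingVertex m) : HammingAut m where
  toEquiv := (Equiv.arrowCongr σ (Equiv.refl (ZMod 2))).trans (Equiv.addRight t)
  map_rel_iff' {α β} := by
    change #{i | α (σ.symm i) + t i ≠ β (σ.symm i) + t i} = 1 ↔ #{i | α i ≠ β i} = 1
    rw [← card_map σ.toEmbedding (s := {i | α i ≠ β i})]
    simp [map_filter]

theorem diffSet_affineAut (σ : Equiv.Perm (Fin m)) (t α β : HammingVertex m) :
    diffSet (affineAut σ t α) (affineAut σ t β) = (diffSet α β).map σ.toEmbedding := by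
  ext i
  rw [mem_map_equiv, mem_diffSet, mem_diffSet]
  exact (add_left_injective (t i)).ne_iff

theorem exists_affineAut_apply_eq (σ : Equiv.Perm (Fin m)) (α α' : HammingVertex m) :
    ∃ t, affineAut σ t α = α' :=
  ⟨α' - affineAut σ 0 α, by
    funext i
    change α (σ.symm i) + (α' i - (α (σ.symm i) + 0)) = α' i
    ring⟩

/-- Two codes are cellwise equivalent if any two vertices at the same distance from them correspond
under an automorphism of `H(m,2)` that carries one distance partition onto the other. A code which
is cellwise equivalent to itself is completely transitive. -/
def AreCellwiseEquivalentCodes (C D : BinaryCode m) : Prop :=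
  ∀ γ γ', distToCode C γ = distToCode D γ' →
    ∃ T : HammingAut m, (∀ β, distToCode D (T β) = distToCode C β) ∧ T γ = γ'

theorem AreCellwiseEquivalentCodes.areEquivalentCodes (h : AreCellwiseEquivalentCodes C D)
    (hC : C.Nonempty) (hD : D.Nonempty) : AreEquivalentCodes C D := by
  obtain ⟨α, hα⟩ := hC
  obtain ⟨β, hβ⟩ := hD
  obtain ⟨T, hT, -⟩ := h α β <| by
    rw [(distToCode_eq_zero_iff ⟨α, hα⟩).2 hα, (distToCode_eq_zero_iff ⟨β, hβ⟩).2 hβ]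
  have hmem (γ : HammingVertex m) : T γ ∈ D ↔ γ ∈ C := by
    rw [← distToCode_eq_zero_iff ⟨β, hβ⟩, hT, distToCode_eq_zero_iff ⟨α, hα⟩]
  refine ⟨T, ext fun η => ⟨fun hη => ?_, fun hη => ?_⟩⟩
  · obtain ⟨γ, hγ, rfl⟩ := mem_image.1 hη
    exact (hmem γ).2 hγ
  · exact mem_image.2 ⟨T.symm η, (hmem _).1 (by rwa [T.apply_symm_apply]), T.apply_symm_apply η⟩

/-- The group of automorphisms of `H(m,2)` that preserve each cell of the distance partition. -/
def cellStabilizer (C : BinaryCode m) : Subgroup (HammingAut m) where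
  carrier := {T | ∀ γ, distToCode C (T γ) = distToCode C γ}
  one_mem' _ := rfl
  mul_mem' {S T} hS hT γ := (hS (T γ)).trans (hT γ)
  inv_mem' {T} hT γ := by
    rw [← hT (T⁻¹ γ)]
    exact congrArg (distToCode C) (T.apply_symm_apply γ)

theorem AreCellwiseEquivalentCodes.isCompletelyTransitive (h : AreCellwiseEquivalentCodes C C)
    (hC : C.Nonempty) : IsCompletelyTransitive C := by
  refine ⟨cellStabilizer C, fun i hi => ?_⟩
  obtain ⟨γ, rfl⟩ := exists_distToCode_eq hC hi
  refine ⟨γ, Set.ext fun γ' => ⟨fun hγ' => ?_, ?_⟩⟩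
  · obtain ⟨T, hT, hTγ⟩ := h γ γ' (Eq.symm hγ')
    exact ⟨⟨T, hT⟩, hTγ⟩
  · rintro ⟨⟨T, hT⟩, rfl⟩
    exact hT γ

theorem exists_hammingAut_of_map_codeFamily {α α' γ γ' : HammingVertex m}
    (σ : Equiv.Perm (Fin m))
    (hfam : (codeFamily C α).map σ.finsetCongr.toEmbedding = codeFamily D α')
    (hγ : (diffSet α γ).map σ.toEmbedding = diffSet α' γ') :
    ∃ T : HammingAut m, (∀ β, distToCode D (T β) = distToCode C β) ∧ T γ = γ' := by
  obtain ⟨t, rfl⟩ := exists_affineAut_apply_eq σ α α'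
  have hmem (β : HammingVertex m) : affineAut σ t β ∈ D ↔ β ∈ C := by
    rw [← diffSet_mem_codeFamily (α := affineAut σ t α), ← hfam, diffSet_affineAut,
      ← diffSet_mem_codeFamily (α := α)]
    exact mem_map' σ.finsetCongr.toEmbedding
  have hdist (β η : HammingVertex m) :
      hammingDist (affineAut σ t β) (affineAut σ t η) = hammingDist β η := by
    rw [← card_diffSet, diffSet_affineAut, card_map, card_diffSet]
  refine ⟨affineAut σ t, fun β => ?_, diffSet_injective _ ((diffSet_affineAut σ t α γ).trans hγ)⟩
  refine congrArg sInf (Set.ext fun d => ((affineAut σ t).surjective.exists).trans ?_)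
  simp only [hmem, hdist]
  rfl

end Codes

section HadamardCodes

open Finset symmDiff

/-- A binary Hadamard code of length `m`: `2 * m` words, closed under complementation, with all
distances equal to `0`, `m / 2` or `m`. These are the codes coming from Hadamard matrices of order
`m`, described without reference to a matrix. -/
structure IsBinaryHadamardCode {m : ℕ} (C : BinaryCode m) : Prop where
  card_eq : #C = 2 * m
  add_one_mem : ∀ α ∈ C, α + 1 ∈ C
  hammingDist_cases : ∀ α ∈ C, ∀ β ∈ C,
    hammingDist α β = 0 ∨ 2 * hammingDist α β = m ∨ hammingDist α β = m

variable {m : ℕ}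

theorem IsBinaryHadamardCode.nonempty [NeZero m] {C : BinaryCode m} (hC : IsBinaryHadamardCode C) :
    C.Nonempty := by
  rw [← card_pos, hC.card_eq]
  exact Nat.mul_pos two_pos (Nat.pos_of_neZero m)

theorem IsBinaryHadamardCode.isHadamardFamily {C : BinaryCode m} (hC : IsBinaryHadamardCode C)
    (α : HammingVertex m) : IsHadamardFamily (codeFamily C α) where
  card_eq := by rw [card_codeFamily, hC.card_eq, Fintype.card_fin]
  compl_mem _ := compl_mem_codeFamily hC.add_one_mem
  card_symmDiff := by
    intro A hA B hB
    obtain ⟨β, hβ, rfl⟩ := mem_codeFamily.1 hA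
    obtain ⟨γ, hγ, rfl⟩ := mem_codeFamily.1 hB
    rw [card_symmDiff_diffSet, Fintype.card_fin]
    exact hC.hammingDist_cases β hβ γ hγ

theorem IsHadamardFamily.card_le_four {α : Type*} [Fintype α] [DecidableEq α]
    {F : Finset (Finset α)} (hF : IsHadamardFamily F) (hα : Fintype.card α = 12) {S : Finset α}
    (hS : ∀ B ∈ F, #S ≤ #(S ∆ B)) : #S ≤ 4 := by
  have : Nonempty α := Fintype.card_pos_iff.1 (by rw [hα]; norm_num)
  obtain ⟨B, hB, hle, hsq⟩ := hF.exists_card_le_sq S univ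
  rw [inter_univ, card_univ, hα, symmDiff_comm] at hle hsq
  have hBS := hS B hB
  push_cast at hsq
  by_contra! h
  nlinarith

theorem IsHadamardFamily.card_erase_le_three {α : Type*} [Fintype α] [DecidableEq α]
    {F : Finset (Finset α)} (hF : IsHadamardFamily F) (hα : Fintype.card α = 12) {S : Finset α}
    {a : α} (hS : ∀ B ∈ F, #(S.erase a) ≤ #((S ∆ B).erase a)) : #(S.erase a) ≤ 3 := by
  have : Nonempty α := ⟨a⟩
  obtain ⟨B, hB, hle, hsq⟩ := hF.exists_card_le_sq S {a}ᶜ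
  rw [← sdiff_eq_inter_compl, sdiff_singleton_eq_erase, card_compl, card_singleton, hα,
    symmDiff_comm] at hle hsq
  have hBS := hS B hB
  push_cast at hsq
  by_contra! h
  nlinarith

theorem IsBinaryHadamardCode.areCellwiseEquivalentCodes {C D : BinaryCode 12}
    (hC : IsBinaryHadamardCode C) (hD : IsBinaryHadamardCode D) :
    AreCellwiseEquivalentCodes C D := by
  intro γ γ' hγ
  obtain ⟨α, hα, h⟩ := exists_hammingDist_eq_distToCode hC.nonempty γ
  obtain ⟨α', hα', h'⟩ := exists_hammingDist_eq_distToCode hD.nonempty γ'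
  have hF := hC.isHadamardFamily α
  have hF' := hD.isHadamardFamily α'
  have h0 := empty_mem_codeFamily hα
  have h0' := empty_mem_codeFamily hα'
  have hS := fun B hB => card_diffSet_le_card_symmDiff (B := B) h hB
  have hS' := fun B hB => card_diffSet_le_card_symmDiff (B := B) h' hB
  have h12 := Fintype.card_fin 12
  have hcard : #(diffSet α γ) = #(diffSet α' γ') := h.trans (hγ.trans h'.symm)
  suffices ∃ σ : Equiv.Perm (Fin 12),
      (codeFamily C α).map σ.finsetCongr.toEmbedding = codeFamily D α' ∧
        (diffSet α γ).map σ.toEmbedding = diffSet α' γ' by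
    obtain ⟨σ, hfam, hset⟩ := this
    exact exists_hammingAut_of_map_codeFamily σ hfam hset
  rcases (diffSet α γ).eq_empty_or_nonempty with hempty | ⟨a, ha⟩
  · obtain ⟨σ, hσ, -⟩ := hF.exists_equiv_map_eq_of_card_eq hF' h0 h0' h12 h12 (S := {0}) (S' := {0})
      rfl (by norm_num) (fun B _ => Nat.le_add_left _ _) (fun B _ => Nat.le_add_left _ _)
      (mem_singleton_self 0) (mem_singleton_self 0)
    rw [hempty, card_empty] at hcard
    refine ⟨σ, hσ, ?_⟩
    rw [hempty, map_empty, card_eq_zero.1 hcard.symm]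
  · obtain ⟨a', ha'⟩ := card_pos.1 (hcard ▸ card_pos.2 ⟨a, ha⟩)
    obtain ⟨σ, hσ, hσS, -⟩ := hF.exists_equiv_map_eq_of_card_eq hF' h0 h0' h12 h12 hcard
      (hF.card_le_four h12 hS) (fun B hB => (hS B hB).trans (Nat.le_succ _))
      (fun B hB => (hS' B hB).trans (Nat.le_succ _)) ha ha'
    exact ⟨σ, hσ, hσS⟩

end HadamardCodes

section Puncturing

open Finset symmDiff

variable {m : ℕ}

/-- The trace of a set of entries on the entries that are left after deleting the first one. -/
def tailSet (B : Finset (Fin (m + 1))) : Finset (Fin m) := {j | j.succ ∈ B}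

theorem mem_tailSet {B : Finset (Fin (m + 1))} {j : Fin m} : j ∈ tailSet B ↔ j.succ ∈ B :=
  mem_filter_univ j

theorem map_succ_tailSet (B : Finset (Fin (m + 1))) :
    (tailSet B).map (Fin.succEmb m) = B.erase 0 := by
  ext i
  refine Fin.cases ?_ (fun j => ?_) i <;> simp [mem_tailSet]

theorem card_tailSet (B : Finset (Fin (m + 1))) : #(tailSet B) = #(B.erase 0) := by
  rw [← map_succ_tailSet, card_map]

theorem tailSet_symmDiff (A B : Finset (Fin (m + 1))) :
    tailSet (A ∆ B) = tailSet A ∆ tailSet B := by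
  ext j
  simp only [mem_tailSet, mem_symmDiff]

theorem tailSet_map {σ : Equiv.Perm (Fin (m + 1))} {τ : Equiv.Perm (Fin m)}
    (h : ∀ j, σ j.succ = (τ j).succ) (B : Finset (Fin (m + 1))) :
    tailSet (B.map σ.toEmbedding) = (tailSet B).map τ.toEmbedding := by
  ext j
  obtain ⟨i, rfl⟩ := τ.surjective j
  rw [mem_tailSet, ← h, mem_map_equiv, mem_map_equiv, mem_tailSet, σ.symm_apply_apply,
    τ.symm_apply_apply]

theorem exists_perm_succ {σ : Equiv.Perm (Fin (m + 1))} (h : σ 0 = 0) :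
    ∃ τ : Equiv.Perm (Fin m), ∀ j, σ j.succ = (τ j).succ := by
  obtain ⟨⟨p, τ⟩, rfl⟩ := Equiv.Perm.decomposeFin.symm.surjective σ
  rw [Equiv.Perm.decomposeFin_symm_apply_zero] at h
  subst h
  exact ⟨τ, fun j => by simp [Equiv.Perm.decomposeFin_symm_apply_succ]⟩

theorem puncturedCode_zero (E : BinaryCode (m + 1)) : puncturedCode 0 E = E.image Fin.tail := by
  simp only [puncturedCode, Fin.succAbove_zero]
  rfl

theorem diffSet_tail (α β : HammingVertex (m + 1)) :
    diffSet (Fin.tail α) (Fin.tail β) = tailSet (diffSet α β) := by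
  ext j
  rw [mem_tailSet, mem_diffSet, mem_diffSet]
  rfl

theorem codeFamily_puncturedCode (E : BinaryCode (m + 1)) (α : HammingVertex (m + 1)) :
    codeFamily (puncturedCode 0 E) (Fin.tail α) = (codeFamily E α).image tailSet := by
  simp only [puncturedCode_zero, codeFamily, image_image]
  exact image_congr fun β _ => diffSet_tail α β

-- Of the two lifts of `γ` to length 12, the one differing from `α` in the deleted entry is used, so
-- that an automorphism matching two such lifts can be chosen to fix the deleted entry.
theorem IsBinaryHadamardCode.exists_tailSet_eq_diffSet {E : BinaryCode 12}
    (hE : IsBinaryHadamardCode E) (γ : HammingVertex 11) :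
    ∃ α ∈ E, ∃ S : Finset (Fin 12), 0 ∈ S ∧ tailSet S = diffSet (Fin.tail α) γ ∧
      #S = distToCode (puncturedCode 0 E) γ + 1 ∧ #S ≤ 4 ∧
      ∀ B ∈ codeFamily E α, #S ≤ #(S ∆ B) + 1 := by
  have hne : (puncturedCode 0 E).Nonempty := hE.nonempty.image _
  obtain ⟨α', hα', h⟩ := exists_hammingDist_eq_distToCode hne γ
  rw [puncturedCode_zero] at hα'
  obtain ⟨α, hα, rfl⟩ := mem_image.1 hα'
  have htail : tailSet (diffSet α (Fin.cons (α 0 + 1) γ)) = diffSet (Fin.tail α) γ := by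
    rw [← diffSet_tail, Fin.tail_cons]
  have h0 : 0 ∈ diffSet α (Fin.cons (α 0 + 1) γ) := by simp [mem_diffSet]
  have hmin : ∀ B ∈ codeFamily E α, #((diffSet α (Fin.cons (α 0 + 1) γ)).erase 0) ≤
      #((diffSet α (Fin.cons (α 0 + 1) γ) ∆ B).erase 0) := by
    intro B hB
    rw [← card_tailSet, ← card_tailSet, tailSet_symmDiff, htail]
    refine card_diffSet_le_card_symmDiff h ?_
    rw [codeFamily_puncturedCode]
    exact mem_image_of_mem tailSet hB
  refine ⟨α, hα, _, h0, htail, ?_, ?_, fun B hB => ?_⟩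
  · rw [← card_erase_add_one h0, ← card_tailSet, htail, card_diffSet, h]
  · have := (hE.isHadamardFamily α).card_erase_le_three (Fintype.card_fin 12) hmin
    rw [← card_erase_add_one h0]
    omega
  · rw [← card_erase_add_one h0]
    exact Nat.succ_le_succ ((hmin B hB).trans card_erase_le)

theorem IsBinaryHadamardCode.areCellwiseEquivalentCodes_puncturedCode {E E' : BinaryCode 12}
    (hE : IsBinaryHadamardCode E) (hE' : IsBinaryHadamardCode E') :
    AreCellwiseEquivalentCodes (puncturedCode 0 E) (puncturedCode 0 E') := by
  intro γ γ' hγ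
  obtain ⟨α, hα, S, h0, htail, hcard, hS4, hS⟩ := hE.exists_tailSet_eq_diffSet γ
  obtain ⟨α', hα', S', h0', htail', hcard', -, hS'⟩ := hE'.exists_tailSet_eq_diffSet γ'
  obtain ⟨σ, hσ, hσS, hσ0⟩ := (hE.isHadamardFamily α).exists_equiv_map_eq_of_card_eq
    (hE'.isHadamardFamily α') (empty_mem_codeFamily hα) (empty_mem_codeFamily hα')
    (Fintype.card_fin 12) (Fintype.card_fin 12) (by rw [hcard, hcard', hγ]) hS4 hS hS' h0 h0'
  obtain ⟨τ, hτ⟩ := exists_perm_succ hσ0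
  refine exists_hammingAut_of_map_codeFamily (α := Fin.tail α) (α' := Fin.tail α') τ ?_ ?_
  · rw [codeFamily_puncturedCode, codeFamily_puncturedCode, ← hσ, map_eq_image, map_eq_image,
      image_image, image_image]
    exact image_congr fun A _ => (tailSet_map hτ A).symm
  · rw [← htail, ← htail', ← hσS, tailSet_map hτ]

end Puncturing

section Regularity

open Finset symmDiff

variable {m δ : ℕ} {C : BinaryCode m} {α β γ : HammingVertex m} {A B T : Finset (Fin m)}

theorem HasMinDistance.ne_zero (hδ : HasMinDistance C δ) : δ ≠ 0 := by
  obtain ⟨α, -, β, -, hne, rfl⟩ := hδ.1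
  exact hammingDist_ne_zero.2 hne

theorem HasMinDistance.distToCode_eq (hδ : HasMinDistance C δ) (hα : α ∈ C)
    (h : 2 * hammingDist α γ ≤ δ) : distToCode C γ = hammingDist α γ := by
  refine le_antisymm (hammingDist_comm γ α ▸ distToCode_le hα γ)
    ((le_distToCode ⟨α, hα⟩).2 fun β hβ => ?_)
  rcases eq_or_ne α β with rfl | hne
  · exact (hammingDist_comm α γ).le
  · have hle := hδ.2 ⟨α, hα, β, hβ, hne, rfl⟩
    have htri := hammingDist_triangle α γ β
    omega

theorem HasMinDistance.le_card_symmDiff (hδ : HasMinDistance C δ) (hA : A ∈ codeFamily C α)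
    (hB : B ∈ codeFamily C α) (hne : A ≠ B) : δ ≤ #(A ∆ B) := by
  obtain ⟨β, hβ, rfl⟩ := mem_codeFamily.1 hA
  obtain ⟨γ, hγ, rfl⟩ := mem_codeFamily.1 hB
  rw [card_symmDiff_diffSet]
  exact hδ.2 ⟨β, hβ, γ, hγ, fun h => hne (congrArg _ h), rfl⟩

theorem HasMinDistance.le_card (hδ : HasMinDistance C δ) (hα : α ∈ C) (hB : B ∈ codeFamily C α)
    (hne : B ≠ ∅) : δ ≤ #B := by
  have h := hδ.le_card_symmDiff hB (empty_mem_codeFamily hα) hne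
  rwa [← bot_eq_empty, symmDiff_bot] at h

theorem HasMinDistance.two_mul_card_inter_le (hδ : HasMinDistance C δ) (hA : A ∈ codeFamily C α)
    (hB : B ∈ codeFamily C α) (hne : A ≠ B) : 2 * #(A ∩ B) + δ ≤ #A + #B := by
  rw [← card_symmDiff_add_two_mul_card_inter, add_comm]
  exact Nat.add_le_add_right (hδ.le_card_symmDiff hA hB hne) _

theorem HasMinDistance.filter_superset_eq_erase (hδ : HasMinDistance C δ) (hα : α ∈ C)
    (hT : #T ≤ δ) :
    {B ∈ {B ∈ codeFamily C α | #B = δ} | T ⊆ B} =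
      erase {B ∈ codeFamily C α | #(T ∆ B) = δ - #T} ∅ := by
  ext B
  simp only [mem_filter, mem_erase, and_assoc, and_left_comm (a := B ≠ ∅)]
  refine and_congr_right fun hB => ?_
  rcases eq_or_ne B ∅ with rfl | hne
  · simp [hδ.ne_zero.symm]
  · have hle := hδ.le_card hα hB hne
    have hsum := card_symmDiff_add_two_mul_card_inter T B
    have hinter := card_le_card (inter_subset_left : T ∩ B ⊆ T)
    have hsub : T ⊆ B ↔ #T ≤ #(T ∩ B) := by
      rw [← inter_eq_left]
      exact ⟨fun h => by rw [h], eq_of_subset_of_card_le inter_subset_left⟩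
    rw [hsub, and_iff_right hne]
    omega

theorem HasMinDistance.exists_mem_card_eq (hδ : HasMinDistance C δ) :
    ∃ α ∈ C, {B ∈ codeFamily C α | #B = δ}.Nonempty := by
  obtain ⟨α, hα, β, hβ, -, hαβ⟩ := hδ.1
  exact ⟨α, hα, diffSet α β, mem_filter.2 ⟨diffSet_mem_codeFamily.2 hβ, hαβ⟩⟩

-- A vertex at distance `t` from `α` is at distance `t` from the code, and the codewords at distance
-- `δ - t` from it are those of weight `δ` over it, together with `α` itself if `δ = 2 * t`.
theorem IsCompletelyRegular.exists_isDesign (hC : IsCompletelyRegular C)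
    (hδ : HasMinDistance C δ) (hα : α ∈ C) {t : ℕ} (ht : 2 * t ≤ δ) :
    ∃ l, IsDesign t δ l {B ∈ codeFamily C α | #B = δ} := by
  have hcount {T T' : Finset (Fin m)} (hT : #T = t) (hT' : #T' = t) :
      #{B ∈ {B ∈ codeFamily C α | #B = δ} | T ⊆ B} =
        #{B ∈ {B ∈ codeFamily C α | #B = δ} | T' ⊆ B} := by
    obtain ⟨γ, rfl⟩ := diffSet_surjective α T
    obtain ⟨γ', rfl⟩ := diffSet_surjective α T'
    rw [card_diffSet] at hT hT'
    have hcell := hC t (δ - t) γ ((hδ.distToCode_eq hα (by omega)).trans hT)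
      γ' ((hδ.distToCode_eq hα (by omega)).trans hT')
    rw [card_filter_hammingDist C α, card_filter_hammingDist C α] at hcell
    rw [hδ.filter_superset_eq_erase hα (by rw [card_diffSet]; omega),
      hδ.filter_superset_eq_erase hα (by rw [card_diffSet]; omega)]
    simp only [card_erase_eq_ite, mem_filter, ← bot_eq_empty, symmDiff_bot, card_diffSet, hT, hT',
      hcell]
  by_cases hex : ∃ T₀ : Finset (Fin m), #T₀ = t
  · obtain ⟨T₀, hT₀⟩ := hex
    exact ⟨_, fun B hB => (mem_filter.1 hB).2, fun T hT => hcount hT hT₀⟩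
  · exact ⟨0, fun B hB => (mem_filter.1 hB).2, fun T hT => (hex ⟨T, hT⟩).elim⟩

theorem IsCompletelyRegular.exists_hammingDist_eq (hC : IsCompletelyRegular C) (hα : α ∈ C)
    (hβ : β ∈ C) (hγ : γ ∈ C) : ∃ η ∈ C, hammingDist γ η = hammingDist α β := by
  have hzero {η : HammingVertex m} (hη : η ∈ C) : η ∈ distCell C 0 :=
    (distToCode_eq_zero_iff ⟨η, hη⟩).2 hη
  have hpos : 0 < #{η ∈ C | hammingDist α η = hammingDist α β} :=
    card_pos.2 ⟨β, mem_filter.2 ⟨hβ, rfl⟩⟩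
  rw [hC 0 _ α (hzero hα) γ (hzero hγ)] at hpos
  obtain ⟨η, hη⟩ := card_pos.1 hpos
  exact ⟨η, mem_filter.1 hη⟩

theorem IsCompletelyRegular.add_one_mem (hC : IsCompletelyRegular C) (hB : B ∈ codeFamily C α)
    (hB' : Bᶜ ∈ codeFamily C α) (hγ : γ ∈ C) : γ + 1 ∈ C := by
  obtain ⟨β, hβ, rfl⟩ := mem_codeFamily.1 hB
  rw [← diffSet_add_one, diffSet_mem_codeFamily] at hB'
  obtain ⟨η, hη, hdist⟩ := hC.exists_hammingDist_eq hβ hB' hγ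
  have hβsum := hammingDist_add_one_add β β
  have hηsum := hammingDist_add_one_add η γ
  rw [hammingDist_self] at hβsum
  rw [hammingDist_comm η γ] at hηsum
  rwa [← hammingDist_eq_zero.1 (by omega : hammingDist η (γ + 1) = 0)]

theorem HasMinDistance.hammingDist_cases (hδ : HasMinDistance C δ)
    (hone : ∀ α ∈ C, α + 1 ∈ C) (hα : α ∈ C) (hβ : β ∈ C) :
    hammingDist α β = 0 ∨ δ ≤ hammingDist α β ∧ hammingDist α β + δ ≤ m ∨
      hammingDist α β = m := by
  have hsum := hammingDist_add_one_add α β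
  rcases eq_or_ne α β with rfl | hne
  · exact Or.inl (hammingDist_self α)
  rcases eq_or_ne α (β + 1) with h | hne'
  · rw [hammingDist_eq_zero.2 h] at hsum
    omega
  · have hle := hδ.2 ⟨α, hα, β, hβ, hne, rfl⟩
    have hle' := hδ.2 ⟨α, hα, β + 1, hone β hβ, hne', rfl⟩
    omega

theorem HasMinDistance.card_cases (hδ : HasMinDistance C δ) (hone : ∀ α ∈ C, α + 1 ∈ C)
    (hα : α ∈ C) (hB : B ∈ codeFamily C α) : #B = 0 ∨ δ ≤ #B ∧ #B + δ ≤ m ∨ #B = m := by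
  obtain ⟨β, hβ, rfl⟩ := mem_codeFamily.1 hB
  exact hδ.hammingDist_cases hone hα hβ

theorem filter_card_eq_zero_codeFamily (hα : α ∈ C) : {B ∈ codeFamily C α | #B = 0} = {∅} := by
  ext B
  rw [mem_filter, card_eq_zero, mem_singleton]
  exact ⟨And.right, fun h => ⟨h ▸ empty_mem_codeFamily hα, h⟩⟩

theorem card_filter_card_codeFamily_of_add_eq (hone : ∀ α ∈ C, α + 1 ∈ C) {k l : ℕ}
    (hkl : k + l = m) :
    #{B ∈ codeFamily C α | #B = k} = #{B ∈ codeFamily C α | #B = l} := by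
  refine card_nbij' compl compl ?_ ?_ (fun _ _ => compl_compl _) (fun _ _ => compl_compl _) <;>
  · intro B hB
    rw [mem_coe, mem_filter] at hB ⊢
    refine ⟨compl_mem_codeFamily hone hB.1, ?_⟩
    rw [card_compl, Fintype.card_fin]
    omega

theorem card_eq_sum_card_filter_card_codeFamily (α : HammingVertex m) {K : Finset ℕ}
    (hK : ∀ B ∈ codeFamily C α, #B ∈ K) :
    #C = ∑ k ∈ K, #{B ∈ codeFamily C α | #B = k} := by
  rw [← card_codeFamily (α := α)]
  exact card_eq_sum_card_fiberwise hK

theorem IsCompletelyRegular.isBinaryHadamardCode {C : BinaryCode 12} (hC : IsCompletelyRegular C)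
    (hδ : HasMinDistance C 6) : IsBinaryHadamardCode C := by
  obtain ⟨α, hα, hne⟩ := hδ.exists_mem_card_eq
  obtain ⟨l, h₃⟩ := hC.exists_isDesign hδ hα (t := 3) le_rfl
  have h12 := Fintype.card_fin 12
  have hI : ∀ B ∈ {B ∈ codeFamily C α | #B = 6}, ∀ B' ∈ {B ∈ codeFamily C α | #B = 6},
      B ≠ B' → #(B ∩ B') ≤ 3 := by
    intro B hB B' hB' hBB'
    rw [mem_filter] at hB hB'
    have := hδ.two_mul_card_inter_le hB.1 hB'.1 hBB'
    omega
  obtain rfl : l = 2 := h₃.eq_two_of_card_eq_twelve h12 hne hI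
  have hone : ∀ γ ∈ C, γ + 1 ∈ C := by
    obtain ⟨B, hB⟩ := hne
    exact fun γ => hC.add_one_mem (mem_filter.1 hB).1
      (mem_filter.1 (h₃.compl_mem_of_card_eq_twelve h12 hI hB)).1
  refine ⟨?_, hone, fun β hβ γ hγ => ?_⟩
  · have h₂ : IsDesign 2 6 5 _ := h₃.of_succ (by norm_num) (by rw [h12])
    have h₁ : IsDesign 1 6 11 _ := h₂.of_succ (by norm_num) (by rw [h12])
    have h₀ : IsDesign 0 6 22 _ := h₁.of_succ (by norm_num) (by rw [h12])
    have hK : ∀ B ∈ codeFamily C α, #B ∈ ({0, 6, 12} : Finset ℕ) := by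
      intro B hB
      have := hδ.card_cases hone hα hB
      simp only [mem_insert, mem_singleton]
      omega
    rw [card_eq_sum_card_filter_card_codeFamily α hK, sum_insert (by decide),
      sum_insert (by decide), sum_singleton, h₀.card_eq,
      ← card_filter_card_codeFamily_of_add_eq hone (zero_add 12),
      filter_card_eq_zero_codeFamily hα, card_singleton]
    rfl
  · have := hδ.hammingDist_cases hone hβ hγ
    omega

end Regularity

section Parity

open Finset symmDiff

variable {m : ℕ}

theorem sum_add_sum_eq_hammingDist (α β : HammingVertex m) :
    ∑ i, α i + ∑ i, β i = (hammingDist α β : ZMod 2) := by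
  have hbit : ∀ a b : ZMod 2, a + b = ((if a ≠ b then 1 else 0 : ℕ) : ZMod 2) := by decide
  rw [← sum_add_distrib, ← card_diffSet, diffSet, card_filter, Nat.cast_sum]
  exact sum_congr rfl fun i _ => hbit (α i) (β i)

/-- The extension of a vertex by an overall parity entry in front. -/
def parityExtension (α : HammingVertex m) : HammingVertex (m + 1) := Fin.cons (∑ i, α i) α

theorem parityExtension_injective : Function.Injective (parityExtension (m := m)) :=
  fun _ _ h => (Fin.cons_inj.1 h).2

theorem hammingDist_parityExtension (α β : HammingVertex m) :
    hammingDist (parityExtension α) (parityExtension β) =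
      hammingDist α β + hammingDist α β % 2 := by
  have hparity : ∑ i, α i = ∑ i, β i ↔ hammingDist α β % 2 = 0 := by
    rw [← CharTwo.add_eq_zero, sum_add_sum_eq_hammingDist, ZMod.natCast_eq_zero_iff_even,
      Nat.even_iff]
  have hbit : hammingDist α β % 2 = if ∑ i, α i ≠ ∑ i, β i then 1 else 0 := by
    simp only [ne_eq, hparity]
    split_ifs <;> omega
  rw [hbit, add_comm (hammingDist α β)]
  simp only [← card_diffSet, diffSet, card_filter, Fin.sum_univ_succ]
  rfl

theorem parityExtension_add_one (hm : Odd m) (α : HammingVertex m) :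
    parityExtension (α + 1) = parityExtension α + 1 := by
  have hm' : (m : ZMod 2) = 1 := ZMod.natCast_eq_one_iff_odd.2 hm
  funext i
  refine Fin.cases ?_ (fun j => ?_) i
  · simp [parityExtension, sum_add_distrib, hm']
  · simp [parityExtension]

theorem puncturedCode_image_parityExtension (C : BinaryCode m) :
    puncturedCode 0 (C.image parityExtension) = C := by
  rw [puncturedCode_zero, image_image]
  exact image_id

theorem isBinaryHadamardCode_image_parityExtension {C : BinaryCode m} (hm : m % 4 = 3)
    (hcard : #C = 2 * (m + 1)) (hone : ∀ α ∈ C, α + 1 ∈ C)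
    (hdist : ∀ α ∈ C, ∀ β ∈ C, hammingDist α β = 0 ∨ 2 * hammingDist α β + 1 = m ∨
      2 * hammingDist α β = m + 1 ∨ hammingDist α β = m) :
    IsBinaryHadamardCode (C.image parityExtension) where
  card_eq := by rw [card_image_of_injective C parityExtension_injective, hcard]
  add_one_mem := by
    simp only [forall_mem_image]
    intro α hα
    rw [← parityExtension_add_one (Nat.odd_iff.2 (by omega))]
    exact mem_image_of_mem _ (hone α hα)
  hammingDist_cases := by
    simp only [forall_mem_image]
    intro α hα β hβ
    rw [hammingDist_parityExtension]
    have := hdist α hα β hβ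
    omega

end Parity

section LengthEleven

open Finset symmDiff

variable {C : BinaryCode 11} {α : HammingVertex 11}

-- Two words of weight 5 whose supports meet in two entries are at distance 6, so by regularity
-- there is a word of weight 6.
theorem IsCompletelyRegular.add_one_mem_of_isDesign (hC : IsCompletelyRegular C)
    (hδ : HasMinDistance C 5) (hα : α ∈ C) (h : IsDesign 2 5 2 {B ∈ codeFamily C α | #B = 5})
    {γ : HammingVertex 11} (hγ : γ ∈ C) : γ + 1 ∈ C := by
  have hpair : 1 < #{B ∈ {B ∈ codeFamily C α | #B = 5} | {0, 1} ⊆ B} := by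
    rw [h.card_through {0, 1} rfl]
    norm_num
  obtain ⟨B, hB, B', hB', hne⟩ := one_lt_card.1 hpair
  simp only [mem_filter] at hB hB'
  have hdist : #(B ∆ B') = 6 := by
    have hsum := card_symmDiff_add_two_mul_card_inter B B'
    have hle := hδ.two_mul_card_inter_le hB.1.1 hB'.1.1 hne
    have hge : 2 ≤ #(B ∩ B') := card_le_card (subset_inter hB.2 hB'.2)
    omega
  obtain ⟨β, hβ, rfl⟩ := mem_codeFamily.1 hB.1.1
  obtain ⟨β', hβ', rfl⟩ := mem_codeFamily.1 hB'.1.1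
  obtain ⟨η, hη, hηdist⟩ := hC.exists_hammingDist_eq hβ hβ' hα
  rw [← card_symmDiff_diffSet α β, hdist, ← card_diffSet] at hηdist
  have hmem : diffSet α η ∈ codeFamily C α := diffSet_mem_codeFamily.2 hη
  refine hC.add_one_mem hmem (mem_filter.1 <| h.compl_mem_of_card_eq_eleven
    (Fintype.card_fin 11) hηdist fun A hA => ?_).1 hγ
  rw [mem_filter] at hA
  have := hδ.two_mul_card_inter_le hA.1 hmem (by rintro rfl; omega)
  omega

theorem IsCompletelyRegular.exists_isBinaryHadamardCode (hC : IsCompletelyRegular C)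
    (hδ : HasMinDistance C 5) : ∃ E, IsBinaryHadamardCode E ∧ C = puncturedCode 0 E := by
  obtain ⟨α, hα, hne⟩ := hδ.exists_mem_card_eq
  obtain ⟨l, h₂⟩ := hC.exists_isDesign hδ hα (t := 2) (by norm_num)
  have h11 := Fintype.card_fin 11
  have hI : ∀ B ∈ {B ∈ codeFamily C α | #B = 5}, ∀ B' ∈ {B ∈ codeFamily C α | #B = 5},
      B ≠ B' → #(B ∩ B') ≤ 2 := by
    intro B hB B' hB' hBB'
    rw [mem_filter] at hB hB'
    have := hδ.two_mul_card_inter_le hB.1 hB'.1 hBB'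
    omega
  obtain rfl : l = 2 := h₂.eq_two_of_card_eq_eleven h11 hne hI
  have hone : ∀ γ ∈ C, γ + 1 ∈ C := fun γ => hC.add_one_mem_of_isDesign hδ hα h₂
  refine ⟨C.image parityExtension, isBinaryHadamardCode_image_parityExtension rfl ?_ hone
    fun β hβ γ hγ => ?_, (puncturedCode_image_parityExtension C).symm⟩
  · have h₁ : IsDesign 1 5 5 _ := h₂.of_succ (by norm_num) (by rw [h11])
    have h₀ : IsDesign 0 5 11 _ := h₁.of_succ (by norm_num) (by rw [h11])
    have hK : ∀ B ∈ codeFamily C α, #B ∈ ({0, 5, 6, 11} : Finset ℕ) := by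
      intro B hB
      have := hδ.card_cases hone hα hB
      simp only [mem_insert, mem_singleton]
      omega
    rw [card_eq_sum_card_filter_card_codeFamily α hK, sum_insert (by decide),
      sum_insert (by decide), sum_insert (by decide), sum_singleton,
      ← card_filter_card_codeFamily_of_add_eq hone (rfl : 5 + 6 = 11), h₀.card_eq,
      ← card_filter_card_codeFamily_of_add_eq hone (zero_add 11),
      filter_card_eq_zero_codeFamily hα, card_singleton]
    rfl
  · have := hδ.hammingDist_cases hone hβ hγ
    omega

end LengthEleven

section HadamardMatrices

open Finset

variable {m : ℕ}

theorem sum_mul_eq_sub_two_mul_hammingDist {u v : Fin m → ℤ} (hu : ∀ i, u i = 1 ∨ u i = -1)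
    (hv : ∀ i, v i = 1 ∨ v i = -1) :
    ∑ i, u i * v i = m - 2 * hammingDist (signToBinary u) (signToBinary v) := by
  have h : ∀ i, u i * v i =
      1 - 2 * ((if signToBinary u i ≠ signToBinary v i then 1 else 0 : ℕ) : ℤ) := by
    intro i
    rcases hu i with h | h <;> rcases hv i with h' | h' <;> simp [signToBinary, h, h']
  rw [sum_congr rfl fun i _ => h i, sum_sub_distrib, ← mul_sum, ← Nat.cast_sum, ← card_filter]
  simp [← card_diffSet, diffSet]

theorem signToBinary_neg {u : Fin m → ℤ} (hu : ∀ i, u i = 1 ∨ u i = -1) :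
    signToBinary (-u) = signToBinary u + 1 := by
  have htwo : (1 : ZMod 2) + 1 = 0 := rfl
  funext i
  rcases hu i with h | h <;> simp [signToBinary, h, htwo]

theorem eq_one_or_eq_neg_one_of_isHadamard {H : Matrix (Fin m) (Fin m) ℤ} (hH : H.IsHadamard)
    (i j : Fin m) : H i j = 1 ∨ H i j = -1 :=
  Int.isUnit_iff.1 (IsUnit.of_mul_eq_one _ (Unitary.mul_star_self_of_mem (hH.apply_mem i j)))

theorem two_mul_hammingDist_signToBinary {H : Matrix (Fin m) (Fin m) ℤ} (hH : H.IsHadamard)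
    {i j : Fin m} (hij : i ≠ j) :
    2 * hammingDist (signToBinary (H i)) (signToBinary (H j)) = m := by
  have hsum := sum_mul_eq_sub_two_mul_hammingDist (eq_one_or_eq_neg_one_of_isHadamard hH i)
    (eq_one_or_eq_neg_one_of_isHadamard hH j)
  have horth : ∑ k, H i k * H j k = 0 := by
    have hmul := congrFun (congrFun hH.mul_conjTranspose i) j
    simpa [Matrix.mul_apply, hij] using hmul
  omega

theorem signToBinary_neg_row {H : Matrix (Fin m) (Fin m) ℤ} (hH : H.IsHadamard) (i : Fin m) :
    signToBinary ((-H) i) = signToBinary (H i) + 1 :=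
  signToBinary_neg (eq_one_or_eq_neg_one_of_isHadamard hH i)

theorem mem_hadamardCode {H : Matrix (Fin m) (Fin m) ℤ} (hH : H.IsHadamard)
    {α : HammingVertex m} :
    α ∈ hadamardCode H ↔ ∃ i, α = signToBinary (H i) ∨ α = signToBinary (H i) + 1 := by
  simp only [hadamardCode, mem_union, mem_image, mem_univ, true_and, signToBinary_neg_row hH,
    exists_or, eq_comm]

theorem card_hadamardCode {H : Matrix (Fin m) (Fin m) ℤ} (hH : H.IsHadamard) :
    #(hadamardCode H) = 2 * m := by
  have hinj : Function.Injective fun i => signToBinary (H i) := by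
    intro i j hij
    by_contra hne
    have hd := two_mul_hammingDist_signToBinary hH hne
    rw [hammingDist_eq_zero.2 hij, mul_zero] at hd
    exact i.pos.ne hd
  have hinj' : Function.Injective fun i => signToBinary ((-H) i) := by
    simp only [signToBinary_neg_row hH]
    exact (add_left_injective 1).comp hinj
  have hdisj : Disjoint (univ.image fun i => signToBinary (H i))
      (univ.image fun i => signToBinary ((-H) i)) := by
    simp only [disjoint_left, mem_image, mem_univ, true_and, forall_exists_index,
      forall_apply_eq_imp_iff, not_exists]
    intro i j hij
    rw [signToBinary_neg_row hH] at hij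
    have hsum := hammingDist_add_one_add (signToBinary (H i)) (signToBinary (H j))
    rw [hij, hammingDist_self, zero_add] at hsum
    have hm := i.pos
    rcases eq_or_ne i j with rfl | hne
    · rw [hammingDist_self] at hsum
      omega
    · have hd := two_mul_hammingDist_signToBinary hH hne
      omega
  rw [hadamardCode, card_union_of_disjoint hdisj, card_image_of_injective _ hinj,
    card_image_of_injective _ hinj', card_univ, Fintype.card_fin, two_mul]

theorem isBinaryHadamardCode_hadamardCode {H : Matrix (Fin m) (Fin m) ℤ} (hH : H.IsHadamard) :
    IsBinaryHadamardCode (hadamardCode H) where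
  card_eq := card_hadamardCode hH
  add_one_mem := by
    intro α hα
    obtain ⟨i, rfl | rfl⟩ := (mem_hadamardCode hH).1 hα
    · exact (mem_hadamardCode hH).2 ⟨i, Or.inr rfl⟩
    · refine (mem_hadamardCode hH).2 ⟨i, Or.inl ?_⟩
      exact funext fun k => CharTwo.add_cancel_right (signToBinary (H i) k) 1
  hammingDist_cases := by
    intro α hα β hβ
    obtain ⟨i, hi⟩ := (mem_hadamardCode hH).1 hα
    obtain ⟨j, hj⟩ := (mem_hadamardCode hH).1 hβ
    have hrow : hammingDist (signToBinary (H i)) (signToBinary (H j)) = 0 ∨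
        2 * hammingDist (signToBinary (H i)) (signToBinary (H j)) = m := by
      rcases eq_or_ne i j with rfl | hne
      · exact Or.inl (hammingDist_self _)
      · exact Or.inr (two_mul_hammingDist_signToBinary hH hne)
    have hright := hammingDist_add_one_add (signToBinary (H i)) (signToBinary (H j))
    have hleft := hammingDist_add_one_add (signToBinary (H j)) (signToBinary (H i))
    have hboth := hammingDist_add_one_add (signToBinary (H i) + 1) (signToBinary (H j))
    simp only [hammingDist_comm (signToBinary (H j))] at hleft
    rcases hi with rfl | rfl <;> rcases hj with rfl | rfl <;> omega

end HadamardMatrices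

theorem theorem1_general :
    (∀ C : BinaryCode 12, IsCompletelyRegular C → HasMinDistance C 6 →
      (∀ H : Matrix (Fin 12) (Fin 12) ℤ, H.IsHadamard → AreEquivalentCodes C (hadamardCode H)) ∧
        IsCompletelyTransitive C) ∧
    (∀ C : BinaryCode 11, IsCompletelyRegular C → HasMinDistance C 5 →
      (∀ H : Matrix (Fin 12) (Fin 12) ℤ, H.IsHadamard →
        AreEquivalentCodes C (puncturedCode 0 (hadamardCode H))) ∧
        IsCompletelyTransitive C) := by
  refine ⟨fun C hC hδ => ?_, fun C hC hδ => ?_⟩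
  · have hCH := hC.isBinaryHadamardCode hδ
    refine ⟨fun H hH => ?_, (hCH.areCellwiseEquivalentCodes hCH).isCompletelyTransitive
      hCH.nonempty⟩
    have hDH := isBinaryHadamardCode_hadamardCode hH
    exact (hCH.areCellwiseEquivalentCodes hDH).areEquivalentCodes hCH.nonempty hDH.nonempty
  · obtain ⟨E, hE, rfl⟩ := hC.exists_isBinaryHadamardCode hδ
    refine ⟨fun H hH => ?_, (hE.areCellwiseEquivalentCodes_puncturedCode hE).isCompletelyTransitive
      (hE.nonempty.image _)⟩
    have hDH := isBinaryHadamardCode_hadamardCode hH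
    exact (hE.areCellwiseEquivalentCodes_puncturedCode hDH).areEquivalentCodes
      (hE.nonempty.image _) (hDH.nonempty.image _)

theorem theorem1 :
    (∀ C : BinaryCode 12, IsCompletelyRegular C → HasMinDistance C 6 →
      (∀ D : BinaryCode 12, IsHadamardTwelveCode D → AreEquivalentCodes C D) ∧
        IsCompletelyTransitive C) ∧
    (∀ C : BinaryCode 11, IsCompletelyRegular C → HasMinDistance C 5 →
      (∀ D : BinaryCode 11, IsPuncturedHadamardTwelveCode D → AreEquivalentCodes C D) ∧
        IsCompletelyTransitive C) := by
  obtain ⟨h₁₂, h₁₁⟩ := theorem1_general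
  exact ⟨fun C hC hδ => (h₁₂ C hC hδ).imp_left fun h _ ⟨H, hH, _, _, hD⟩ => hD ▸ h H hH,
    fun C hC hδ => (h₁₁ C hC hδ).imp_left fun h _ ⟨_, ⟨H, hH, _, _, hD'⟩, hD⟩ =>
      hD ▸ hD' ▸ h H hH⟩
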